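/- For $n\ge 0$ let $\mathbb{M}_n$ be the set of matroids with ground set $[n]=\{1,\ldots,n\}$, let $\mathbb{M}_{n,r}\subseteq\mathbb{M}_n$ be the set of those of rank $r$, and let $\mathbb{M}=\bigcup_n\mathbb{M}_n$. A non-basis of a matroid $M$ of rank $r$ is an $r$-element subset of its ground set that is not a basis, a circuit-hyperplane is a set that is both a circuit and a hyperplane (a flat of rank $r-1$) of $M$, and $U(M)$ is the set of non-bases of $M$ that are not circuit-hyperplanes of $M$. A class $\mathcal{N}\subseteq\mathbb{M}$ is said to contain almost all matroids if $|\mathcal{N}\cap\mathbb{M}_n|/|\mathbb{M}_n|\to 1$ as $n\to\infty$. Write $\log$ for the base-$2$ logarithm. **Theorem.** There are a constant $c>0$ and a class of matroids $\mathcal{N}\subseteq\mathbb{M}$ containing almost all matroids such that, for all integers $n\ge 1$ and $0\le r\le n$, $$\log\bigl|\{U(M): M\in\mathbb{M}_{n,r}\cap\mathcal{N}\}\bigr|\;\le\; c\,\frac{\log(n)^3}{n^2}\binom{n}{\lfloor n/2\rfloor}$$ (where the bound is regarded as true if the set on the left is empty). -/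

import Mathlib

open Filter Topology

namespace Matroid

/-- The non-bases of `M`: the sets `X ⊆ E(M)` with `|X| = r(M)` that are not bases. -/
def nonbases {α : Type*} (M : Matroid α) : Set (Set α) :=
  {X | X ⊆ M.E ∧ X.encard = M.eRank ∧ ¬ M.IsBase X}

/-- A hyperplane of `M`: a flat of rank `r(M) - 1` (for matroids of finite rank). -/
def IsHyperplane {α : Type*} (M : Matroid α) (H : Set α) : Prop :=
  M.IsFlat H ∧ M.eRk H + 1 = M.eRank

/-- `W(M)`: the set of circuit-hyperplanes of `M`. -/
def circuitHyperplanes {α : Type*} (M : Matroid α) : Set (Set α) :=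
  {X | M.IsCircuit X ∧ M.IsHyperplane X}

/-- `U(M)`: the non-bases of `M` that are not circuit-hyperplanes. -/
def bigNonbases {α : Type*} (M : Matroid α) : Set (Set α) :=
  M.nonbases \ M.circuitHyperplanes

/-- `𝕄_n`: the set of (labelled) matroids whose ground set is the standard `n`-element set. -/
def matroidsOn (n : ℕ) : Set (Matroid (Fin n)) :=
  {M | M.E = Set.univ}

/-- `𝕄_{n,r}`: the matroids in `𝕄_n` of rank `r`. -/
def matroidsOnOfRank (n r : ℕ) : Set (Matroid (Fin n)) :=
  {M | M ∈ matroidsOn n ∧ M.eRank = (r : ℕ∞)}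

/-- Almost all matroids are in the class `𝒩` (given by its members on `n` elements for each `n`):
`|𝒩 ∩ 𝕄_n| / |𝕄_n| → 1` as `n → ∞`. -/
def ContainsAlmostAll (𝒩 : (n : ℕ) → Set (Matroid (Fin n))) : Prop :=
  Tendsto (fun n : ℕ => ((𝒩 n ∩ matroidsOn n).ncard : ℝ) / ((matroidsOn n).ncard : ℝ))
    atTop (𝓝 1)

end Matroid

/-!
# Counting the big non-bases of almost all matroids

For a matroid of rank `r` on `n` elements, with `0 < r < n`, let `K` be the family of non-bases,
viewed as a set of vertices of the Johnson graph (`Adj`). A non-basis is a circuit-hyperplane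
exactly if it has no neighbour in `K`, so `U(M)` is the family `clustered K` of non-bases that do
have one (`bigNonbases_eq`). A non-basis `X` that is adjacent to a basis contains a unique circuit
`circ K X` and spans a hyperplane, with complement `cocirc K X`, and every `r`-set that contains
this circuit or lies in this hyperplane is again a non-basis. Two adjacent such non-bases share
their circuit or their hyperplane. These facts are collected, in a form invariant under duality, in
`IsNonbasisFamily`, and the argument works with such families.

*Covers.* Write `N = (n choose n / 2)`. For `n / 4 ≤ r ≤ 3 n / 4`, greedy selection combined with
supersaturation in the Johnson graph produces `O(N log n / n ^ 2)` members of `clustered K` whose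
circuits and hyperplanes (or, for a member adjacent to no basis, whose neighbours) certify most of
`clustered K`: every member of `clustered K` has at most
`n / 10` neighbours in `clustered K` that are not certified, and the uncertified members are `Good`,
that is, they have large circuits and cocircuits (`exists_isValid`). The circuit and the hyperplane
of an uncertified member can then be read off from the cover by majority (`approxCirc`,
`approxCocirc`). Consequently, if uncertified sets that share a circuit or a hyperplane are called
linked, each class of linked sets is determined by the cover and any one of its members
(`IsValid.reflTransGen_step_iff`), and `clustered K` is determined by the cover and one
representative of each class.

*Few classes.* If there are `O(N (log n) ^ 2 / n ^ 2)` classes, then `K` is called tame. The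
description consists of `O(N (log n) ^ 2 / n ^ 2)` subsets of an `n`-element set; such a family of
sets can be chosen in at most `2 ^ O(N (log n) ^ 3 / n ^ 2)` ways (`IsLarge.card_smallFamilies_le`),
which is the asserted bound.

*Many classes.* Every stable set of the Johnson graph is the family of non-bases of a sparse paving
matroid (`exists_nonbasisFamily_eq`), so it suffices to show that the families that are not tame are
few compared to stable families. Fix a cover and let `X` run through representatives of the classes
of `K`. If `X` is properly contained in its hyperplane, then, for a suitable `g` in its circuit, it
can be replaced by `X - g + f` with `f` in the hyperplane. Choosing independently for each class
whether to replace the representative, and adding the circuit-hyperplanes, always yields a stable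
family, and the cover, `g`, and this stable family determine `K`. If `q` of the classes allow the
exchange with the same `g`, this gives `2 ^ q` encodings of `K`, so the number of such `K` is at
most `n * 2 ^ (-q)` times the number of stable families (`card_mul_two_pow_le`). Representatives
that properly contain their circuit are handled by duality, and each representative, being adjacent
to a non-basis, is of one of these two kinds. As `2 ^ q` exceeds the number of covers by far, almost
all matroids are tame (`containsAlmostAll_tameMatroids`).

Ranks below `n / 4` and above `3 n / 4` need no such argument, as then, for large `n`, there are at
most `N / n ^ 2` sets of size `r`.
-/

open scoped FinsetFamily

namespace MatroidCount

section

variable {α : Type*} [DecidableEq α]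

/-! ### Adjacency in the Johnson graph -/

/-- The set `X - e + f`. It is a neighbour of `X` in the Johnson graph if `e ∈ X` and `f ∉ X`. -/
def swap (X : Finset α) (e f : α) : Finset α := insert f (X.erase e)

/-- Adjacency in the Johnson graph: `Y` arises from `X` by exchanging one element. -/
def Adj (X Y : Finset α) : Prop := ∃ e ∈ X, ∃ f ∉ X, Y = swap X e f

theorem mem_swap {X : Finset α} {e f a : α} : a ∈ swap X e f ↔ a = f ∨ (a ≠ e ∧ a ∈ X) := by
  simp [swap]

theorem card_swap {X : Finset α} {e f : α} (he : e ∈ X) (hf : f ∉ X) :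
    (swap X e f).card = X.card := by
  rw [swap, Finset.card_insert_of_notMem (by simp [hf]), Finset.card_erase_of_mem he]
  have := Finset.card_pos.2 ⟨e, he⟩
  omega

theorem swap_swap {X : Finset α} {e f : α} (he : e ∈ X) (hf : f ∉ X) :
    swap (swap X e f) f e = X := by
  ext a
  simp only [mem_swap]
  grind

theorem notMem_swap {X : Finset α} {e f : α} (he : e ∈ X) (hf : f ∉ X) : e ∉ swap X e f := by
  simp only [mem_swap]
  grind

theorem mem_swap_self {X : Finset α} {e f : α} : f ∈ swap X e f := by
  simp [mem_swap]

theorem swap_subset_insert {X : Finset α} {e f : α} : swap X e f ⊆ insert f X := by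
  intro a; simp only [mem_swap, Finset.mem_insert]; tauto

theorem compl_swap [Fintype α] {X : Finset α} {e f : α} (he : e ∈ X) (hf : f ∉ X) :
    (swap X e f)ᶜ = swap Xᶜ f e := by
  ext a
  simp only [mem_swap, Finset.mem_compl]
  grind

theorem swap_injOn [Fintype α] (X : Finset α) :
    Set.InjOn (fun p : α × α => swap X p.1 p.2) (X ×ˢ Xᶜ : Finset (α × α)) := by
  rintro ⟨e, f⟩ h ⟨e', f'⟩ h' heq
  simp only [Finset.coe_product, Set.mem_prod, Finset.mem_coe, Finset.mem_compl] at h h'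
  have h1 : ∀ a, a ∈ swap X e f ↔ a ∈ swap X e' f' := fun a => by
    rw [show swap X e f = swap X e' f' from heq]
  simp only [mem_swap] at h1
  have := h1 e
  have := h1 f
  grind

theorem Adj.symm {X Y : Finset α} (h : Adj X Y) : Adj Y X := by
  obtain ⟨e, he, f, hf, rfl⟩ := h
  exact ⟨f, mem_swap_self, e, notMem_swap he hf, (swap_swap he hf).symm⟩

theorem Adj.card_eq {X Y : Finset α} (h : Adj X Y) : Y.card = X.card := by
  obtain ⟨e, he, f, hf, rfl⟩ := h
  exact card_swap he hf

theorem Adj.compl [Fintype α] {X Y : Finset α} (h : Adj X Y) : Adj Xᶜ Yᶜ := by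
  obtain ⟨e, he, f, hf, rfl⟩ := h
  exact ⟨f, by simpa using hf, e, by simpa using he, compl_swap he hf⟩

theorem Adj.irrefl {X : Finset α} : ¬ Adj X X := by
  rintro ⟨e, he, f, hf, h⟩
  exact notMem_swap he hf (h ▸ he)

theorem adj_swap_swap {X : Finset α} {e f g : α} (hf : f ∉ X) (he : e ∈ X) (hg : g ∈ X)
    (h : e ≠ g) :
    Adj (swap X g f) (swap X e f) := by
  refine ⟨e, ?_, g, notMem_swap hg hf, ?_⟩
  · rw [mem_swap]; tauto
  · ext x; simp only [mem_swap]; grind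

theorem adj_of_le_card_inter {X Y : Finset α} {r : ℕ} (hX : X.card = r) (hY : Y.card = r)
    (hne : X ≠ Y)
    (h : r - 1 ≤ (X ∩ Y).card) : Adj X Y := by
  have h1 := Finset.card_sdiff_add_card_inter X Y
  have h2 := Finset.card_sdiff_add_card_inter Y X
  rw [Finset.inter_comm] at h2
  have h3 : (X \ Y).Nonempty := by
    rw [Finset.nonempty_iff_ne_empty]
    intro h
    exact hne (Finset.eq_of_subset_of_card_le (Finset.sdiff_eq_empty_iff_subset.1 h) (by omega))
  have h4 := Finset.card_pos.2 h3
  obtain ⟨e, he⟩ := Finset.card_eq_one.1 (show (X \ Y).card = 1 by omega)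
  obtain ⟨f, hf⟩ := Finset.card_eq_one.1 (show (Y \ X).card = 1 by omega)
  have he' : ∀ a, a ∈ X ∧ a ∉ Y ↔ a = e := fun a => by
    rw [← Finset.mem_sdiff, he, Finset.mem_singleton]
  have hf' : ∀ a, a ∈ Y ∧ a ∉ X ↔ a = f := fun a => by
    rw [← Finset.mem_sdiff, hf, Finset.mem_singleton]
  refine ⟨e, ((he' e).2 rfl).1, f, ((hf' f).2 rfl).2, ?_⟩
  ext a
  rw [mem_swap]
  have := he' a
  have := hf' a
  tauto

/-! ### Families of non-bases -/

variable [Fintype α]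

/-- For a non-basis `X` in a family `K` of non-bases, the elements of `X` that take part in an
exchange leading to a basis. If `X` spans a hyperplane, this is the unique circuit in `X`. -/
def circ (K : Finset (Finset α)) (X : Finset α) : Finset α :=
  X.filter fun e => ∃ f ∉ X, swap X e f ∉ K

/-- The elements outside `X` that take part in an exchange leading to a basis. If `X` spans a
hyperplane, this is the complement of that hyperplane. -/
def cocirc (K : Finset (Finset α)) (X : Finset α) : Finset α :=
  Xᶜ.filter fun f => ∃ e ∈ X, swap X e f ∉ K

/-- The combinatorial properties of the family `K` of all non-bases of a matroid of rank `r` on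
which the counting rests. They are invariant under taking complements of all members, which
interchanges `circ` and `cocirc`. -/
structure IsNonbasisFamily (r : ℕ) (K : Finset (Finset α)) : Prop where
  card_eq : ∀ X ∈ K, X.card = r
  rect : ∀ X ∈ K, ∀ e ∈ circ K X, ∀ f ∈ cocirc K X, swap X e f ∉ K
  mem_of_circ_subset : ∀ X ∈ K, (circ K X).Nonempty → ∀ Y, Y.card = r → circ K X ⊆ Y → Y ∈ K
  mem_of_disjoint_cocirc : ∀ X ∈ K, (circ K X).Nonempty →
    ∀ Y, Y.card = r → Disjoint Y (cocirc K X) → Y ∈ K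

/-- The members of `K` that are adjacent to another member of `K`. When `K` consists of the
non-bases of a matroid, these are the non-bases that are not circuit-hyperplanes. -/
def clustered (K : Finset (Finset α)) : Finset (Finset α) :=
  K.filter fun X => ∃ e ∈ X, ∃ f ∉ X, swap X e f ∈ K

section basic

variable {K : Finset (Finset α)} {X Y : Finset α} {e f : α} {r : ℕ}

theorem mem_circ : e ∈ circ K X ↔ e ∈ X ∧ ∃ f ∉ X, swap X e f ∉ K := by simp [circ]

theorem mem_cocirc : f ∈ cocirc K X ↔ f ∉ X ∧ ∃ e ∈ X, swap X e f ∉ K := by simp [cocirc]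

theorem circ_subset : circ K X ⊆ X := Finset.filter_subset _ _

theorem disjoint_cocirc : Disjoint X (cocirc K X) := by
  rw [Finset.disjoint_left]
  intro a ha h
  exact (mem_cocirc.1 h).1 ha

theorem circ_nonempty_iff : (circ K X).Nonempty ↔ ∃ e ∈ X, ∃ f ∉ X, swap X e f ∉ K := by
  simp only [Finset.Nonempty, mem_circ]

theorem cocirc_nonempty_iff : (cocirc K X).Nonempty ↔ (circ K X).Nonempty := by
  rw [circ_nonempty_iff]
  simp only [Finset.Nonempty, mem_cocirc]
  constructor
  · rintro ⟨f, hf, e, he, h⟩; exact ⟨e, he, f, hf, h⟩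
  · rintro ⟨e, he, f, hf, h⟩; exact ⟨f, hf, e, he, h⟩

theorem mem_clustered : X ∈ clustered K ↔ X ∈ K ∧ ∃ e ∈ X, ∃ f ∉ X, swap X e f ∈ K := by
  simp [clustered]

theorem mem_clustered_of_adj (hX : X ∈ K) (hY : Y ∈ K) (h : Adj X Y) : X ∈ clustered K := by
  obtain ⟨e, he, f, hf, rfl⟩ := h
  exact mem_clustered.2 ⟨hX, e, he, f, hf, hY⟩

theorem not_adj_of_notMem_clustered (hX : X ∈ K) (hX' : X ∉ clustered K) (hY : Y ∈ K) :
    ¬ Adj X Y := fun h => hX' (mem_clustered_of_adj hX hY h)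

theorem swap_mem_of_notMem_circ (he : e ∈ X) (hf : f ∉ X) (h : e ∉ circ K X) :
    swap X e f ∈ K := by
  by_contra h'
  exact h (mem_circ.2 ⟨he, f, hf, h'⟩)

theorem swap_mem_of_notMem_cocirc (he : e ∈ X) (hf : f ∉ X) (h : f ∉ cocirc K X) :
    swap X e f ∈ K := by
  by_contra h'
  exact h (mem_cocirc.2 ⟨hf, e, he, h'⟩)

end basic

namespace IsNonbasisFamily

variable {K : Finset (Finset α)} {X Y : Finset α} {e f g : α} {r : ℕ}

theorem swap_notMem_iff (hK : IsNonbasisFamily r K) (hX : X ∈ K) (he : e ∈ X) (hf : f ∉ X) :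
    swap X e f ∉ K ↔ e ∈ circ K X ∧ f ∈ cocirc K X :=
  ⟨fun h => ⟨mem_circ.2 ⟨he, f, hf, h⟩, mem_cocirc.2 ⟨hf, e, he, h⟩⟩,
    fun h => hK.rect X hX e h.1 f h.2⟩

theorem circ_eq_of_circ_subset (hK : IsNonbasisFamily r K) (hX : X ∈ K) (hY : Y ∈ K)
    (hX' : (circ K X).Nonempty) (hY' : (circ K Y).Nonempty) (h : circ K X ⊆ Y) :
    circ K Y = circ K X := by
  have key : ∀ {X Y : Finset α}, X ∈ K → Y ∈ K → (circ K X).Nonempty → circ K X ⊆ Y →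
      circ K Y ⊆ circ K X := by
    intro X Y hX hY hX' h e he
    by_contra he'
    obtain ⟨heY, f, hf, hs⟩ := mem_circ.1 he
    refine hs (hK.mem_of_circ_subset X hX hX' _ ?_ ?_)
    · rw [card_swap heY hf, hK.card_eq Y hY]
    · intro a ha
      have := h ha
      rw [mem_swap]
      by_cases hae : a = e
      · exact absurd (hae ▸ ha) he'
      · exact Or.inr ⟨hae, this⟩
  have h1 := key hX hY hX' h
  exact h1.antisymm (key hY hX hY' (h1.trans circ_subset))

theorem cocirc_eq_of_disjoint (hK : IsNonbasisFamily r K) (hX : X ∈ K) (hY : Y ∈ K)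
    (hX' : (circ K X).Nonempty) (hY' : (circ K Y).Nonempty) (h : Disjoint Y (cocirc K X)) :
    cocirc K Y = cocirc K X := by
  have key : ∀ {X Y : Finset α}, X ∈ K → Y ∈ K → (circ K X).Nonempty → Disjoint Y (cocirc K X) →
      cocirc K Y ⊆ cocirc K X := by
    intro X Y hX hY hX' h f hf
    by_contra hf'
    obtain ⟨hfY, e, he, hs⟩ := mem_cocirc.1 hf
    refine hs (hK.mem_of_disjoint_cocirc X hX hX' _ ?_ ?_)
    · rw [card_swap he hfY, hK.card_eq Y hY]
    · rw [Finset.disjoint_left] at h ⊢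
      intro a ha
      rcases mem_swap.1 ha with rfl | ⟨-, ha⟩
      · exact hf'
      · exact h ha
  have h1 := key hX hY hX' h
  exact h1.antisymm (key hY hX hY' (disjoint_cocirc.mono_right h1))

/-- Two adjacent non-bases, each adjacent to a basis, share their circuit or their hyperplane. -/
theorem circ_eq_or_cocirc_eq_of_adj (hK : IsNonbasisFamily r K) (hX : X ∈ K) (hY : Y ∈ K)
    (hX' : (circ K X).Nonempty) (hY' : (circ K Y).Nonempty) (h : Adj X Y) :
    circ K Y = circ K X ∨ cocirc K Y = cocirc K X := by
  obtain ⟨e, he, f, hf, rfl⟩ := h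
  by_cases hec : e ∈ circ K X
  · right
    apply hK.cocirc_eq_of_disjoint hX hY hX' hY'
    rw [Finset.disjoint_left]
    intro a ha had
    rcases mem_swap.1 ha with rfl | ⟨-, ha⟩
    · exact hK.rect X hX e hec a had hY
    · exact (mem_cocirc.1 had).1 ha
  · left
    apply hK.circ_eq_of_circ_subset hX hY hX' hY'
    intro a ha
    rw [mem_swap]
    exact Or.inr ⟨fun h => hec (h ▸ ha), circ_subset ha⟩

/-- The sets that contain the circuit of a clustered non-basis are not only non-bases, but clustered
themselves. -/
theorem mem_clustered_of_circ_subset (hK : IsNonbasisFamily r K) (hX : X ∈ clustered K)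
    (hX' : (circ K X).Nonempty) (hY : Y.card = r) (h : circ K X ⊆ Y) : Y ∈ clustered K := by
  have hXK := (mem_clustered.1 hX).1
  have hYK := hK.mem_of_circ_subset X hXK hX' Y hY h
  by_contra hYc
  have hall : ∀ e ∈ Y, ∀ f ∉ Y, swap Y e f ∉ K := by
    intro e he f hf hs
    exact hYc (mem_clustered.2 ⟨hYK, e, he, f, hf, hs⟩)
  obtain ⟨e, he, f, hf, -⟩ := circ_nonempty_iff.1 hX'
  have hcard : X.card = Y.card := by rw [hY, hK.card_eq X hXK]
  obtain ⟨f', hf'⟩ : ∃ f', f' ∉ Y := by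
    by_contra! hall
    have h1 : Y = Finset.univ := Finset.eq_univ_iff_forall.2 hall
    have h2 : X = Finset.univ := by rw [← Finset.card_eq_iff_eq_univ, hcard, h1, Finset.card_univ]
    exact hf (h2 ▸ Finset.mem_univ f)
  have hcY : circ K Y = Y := by
    apply circ_subset.antisymm
    intro a ha
    exact mem_circ.2 ⟨ha, f', hf', hall a ha f' hf'⟩
  have hYne : (circ K Y).Nonempty := hX'.mono (h.trans hcY.ge)
  have h1 := hK.circ_eq_of_circ_subset hXK hYK hX' hYne h
  have h2 : Y ⊆ X := by rw [← hcY, h1]; exact circ_subset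
  exact hYc (Finset.eq_of_subset_of_card_le h2 hcard.le ▸ hX)

theorem swap_mem_of_circ_eq_empty (he : e ∈ X) (hf : f ∉ X)
    (h : circ K X = ∅) : swap X e f ∈ K :=
  swap_mem_of_notMem_circ he hf (by simp [h])

theorem mem_clustered_of_adj_of_circ_eq_empty (hX : X ∈ K) (h : circ K X = ∅)
    (hXY : Adj X Y) : Y ∈ clustered K := by
  obtain ⟨e, he, f, hf, rfl⟩ := id hXY
  exact mem_clustered_of_adj (swap_mem_of_circ_eq_empty he hf h) hX hXY.symm

end IsNonbasisFamily

/-! ### Duality -/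

section dual

variable {K : Finset (Finset α)} {X Y : Finset α} {e f g : α} {r : ℕ}

theorem compl_swap_mem_compls (he : e ∉ X) (hf : f ∈ X) : swap Xᶜ e f ∈ Kᶜˢ ↔ swap X f e ∈ K := by
  rw [Finset.mem_compls, ← compl_swap hf he, compl_compl]

theorem circ_compls : circ Kᶜˢ Xᶜ = cocirc K X := by
  ext e
  rw [mem_circ, mem_cocirc, Finset.mem_compl]
  refine and_congr_right fun he => ?_
  constructor
  · rintro ⟨f, hf, h⟩
    rw [Finset.mem_compl, not_not] at hf
    exact ⟨f, hf, by rwa [compl_swap_mem_compls he hf] at h⟩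
  · rintro ⟨f, hf, h⟩
    exact ⟨f, by simpa using hf, by rwa [compl_swap_mem_compls he hf]⟩

theorem cocirc_compls : cocirc Kᶜˢ Xᶜ = circ K X := by
  have := circ_compls (K := Kᶜˢ) (X := Xᶜ)
  rw [Finset.compls_compls, compl_compl] at this
  exact this.symm

theorem clustered_compls : clustered Kᶜˢ = (clustered K)ᶜˢ := by
  ext X
  rw [Finset.mem_compls, mem_clustered, mem_clustered, Finset.mem_compls]
  refine and_congr_right fun hX => ?_
  constructor
  · rintro ⟨e, he, f, hf, h⟩
    refine ⟨f, by simpa using hf, e, by simpa using he, ?_⟩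
    rw [← compl_swap he hf]
    simpa using h
  · rintro ⟨e, he, f, hf, h⟩
    refine ⟨f, by simpa using hf, e, by simpa using he, ?_⟩
    rw [Finset.mem_compls, compl_swap (by simpa using hf) (by simpa using he)]
    exact h

end dual
namespace IsNonbasisFamily
variable {K : Finset (Finset α)} {X Y : Finset α} {e f g : α} {r : ℕ}

theorem compls (hK : IsNonbasisFamily r K) : IsNonbasisFamily (Fintype.card α - r) Kᶜˢ where
  card_eq X hX := by
    rw [Finset.mem_compls] at hX
    have h1 := hK.card_eq _ hX
    rw [Finset.card_compl] at h1
    have := Finset.card_le_univ X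
    omega
  rect X hX e he f hf := by
    rw [← compl_compl X] at he hf
    rw [circ_compls] at he
    rw [cocirc_compls] at hf
    rw [Finset.mem_compls] at hX
    have := hK.rect _ hX f hf e he
    rw [← compl_compl X, compl_swap_mem_compls (mem_cocirc.1 he).1 (circ_subset hf)]
    exact this
  mem_of_circ_subset X hX hX' Y hY h := by
    rw [← compl_compl X] at h hX'
    rw [circ_compls] at h hX'
    rw [Finset.mem_compls] at hX ⊢
    refine hK.mem_of_disjoint_cocirc _ hX (cocirc_nonempty_iff.1 hX') _ ?_ ?_
    · rw [Finset.card_compl, hY, ← hK.card_eq _ hX]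
      have := Finset.card_le_univ Xᶜ
      omega
    · exact disjoint_compl_left.mono_right h
  mem_of_disjoint_cocirc X hX hX' Y hY h := by
    rw [← compl_compl X] at h hX'
    rw [cocirc_compls] at h
    rw [circ_compls] at hX'
    rw [Finset.mem_compls] at hX ⊢
    refine hK.mem_of_circ_subset _ hX (cocirc_nonempty_iff.1 hX') _ ?_ ?_
    · rw [Finset.card_compl, hY, ← hK.card_eq _ hX]
      have := Finset.card_le_univ Xᶜ
      omega
    · intro a ha
      rw [Finset.mem_compl]
      exact fun h' => Finset.disjoint_left.1 h h' ha

theorem mem_clustered_of_disjoint_cocirc (hK : IsNonbasisFamily r K) (hX : X ∈ clustered K)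
    (hX' : (circ K X).Nonempty) (hY : Y.card = r) (h : Disjoint Y (cocirc K X)) :
    Y ∈ clustered K := by
  have hc := hK.compls.mem_clustered_of_circ_subset (X := Xᶜ) (Y := Yᶜ)
    (by rw [clustered_compls]; simpa using hX)
    (by rw [circ_compls]; exact cocirc_nonempty_iff.2 hX')
    (by rw [Finset.card_compl, hY])
    (by
      rw [circ_compls]
      intro a ha
      rw [Finset.mem_compl]
      exact fun h' => Finset.disjoint_left.1 h h' ha)
  rw [clustered_compls] at hc
  simpa using hc

/-- An exchange inside a hyperplane that removes an element of the circuit stays a non-basis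
spanning that hyperplane. -/
theorem swap_properties (hK : IsNonbasisFamily r K) (hX : X ∈ K) (hg : g ∈ circ K X) (hf : f ∉ X)
    (hf' : f ∉ cocirc K X) : swap X g f ∈ K ∧ (circ K (swap X g f)).Nonempty ∧
      cocirc K (swap X g f) = cocirc K X := by
  have hgX := circ_subset hg
  have h1 : swap X g f ∈ K := swap_mem_of_notMem_cocirc hgX hf hf'
  have hX' : (circ K X).Nonempty := ⟨g, hg⟩
  obtain ⟨f₂, hf₂⟩ := cocirc_nonempty_iff.2 hX'
  have h2 : (circ K (swap X g f)).Nonempty := by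
    rw [circ_nonempty_iff]
    have hne : f₂ ≠ f := fun h => hf' (h ▸ hf₂)
    have hf₂X := (mem_cocirc.1 hf₂).1
    refine ⟨f, mem_swap_self, f₂, ?_, ?_⟩
    · rw [mem_swap]; tauto
    · have : swap (swap X g f) f f₂ = swap X g f₂ := by
        ext a; simp only [mem_swap]; grind
      rw [this]
      exact hK.rect X hX g hg f₂ hf₂
  refine ⟨h1, h2, hK.cocirc_eq_of_disjoint hX h1 hX' h2 ?_⟩
  rw [Finset.disjoint_left]
  intro a ha had
  rcases mem_swap.1 ha with rfl | ⟨-, ha⟩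
  · exact hf' had
  · exact (mem_cocirc.1 had).1 ha

end IsNonbasisFamily

end

section

variable {α : Type*} [DecidableEq α] [Fintype α]

/-! ### Covering non-bases by circuits and hyperplanes -/

/-- A compressed partial description of a family of non-bases: a collection of circuits, a
collection of complements of hyperplanes, and a collection of non-bases that are not adjacent to
any basis. -/
abbrev Cover (α : Type*) := Finset (Finset α) × Finset (Finset α) × Finset (Finset α)

/-- `X` contains one of the circuits, or lies in one of the hyperplanes, listed in `Z`. -/
def Covered (Z : Cover α) (X : Finset α) : Prop :=
  (∃ C ∈ Z.1, C ⊆ X) ∨ ∃ D ∈ Z.2.1, Disjoint X D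

open Classical in
/-- The `r`-sets that `Z` certifies to be non-bases. -/
noncomputable def region (r : ℕ) (Z : Cover α) : Finset (Finset α) :=
  Finset.univ.filter fun X => X.card = r ∧ (Covered Z X ∨ ∃ Y ∈ Z.2.2, X = Y ∨ Adj Y X)

/-- The approximation of `circ K X` that can be read off from a set `V` of known non-bases: the
elements of `X` for which more than `t` exchanges do not lead into `V`. -/
def approxCirc (t : ℕ) (V : Finset (Finset α)) (X : Finset α) : Finset α :=
  X.filter fun e => t < (Xᶜ.filter fun f => swap X e f ∉ V).card

/-- The approximation of `cocirc K X` that can be read off from a set `V` of known non-bases. -/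
def approxCocirc (t : ℕ) (V : Finset (Finset α)) (X : Finset α) : Finset α :=
  Xᶜ.filter fun f => t < (X.filter fun e => swap X e f ∉ V).card

/-- `X` has a large circuit, and the complement of its hyperplane is large. -/
def Good (K : Finset (Finset α)) (X : Finset α) : Prop :=
  X.card < 2 * (circ K X).card ∧ Xᶜ.card < 2 * (cocirc K X).card

/-- The good members of `clustered K` that contain no circuit and lie in no hyperplane listed in
`Z`. -/
def Live (K : Finset (Finset α)) (Z : Cover α) (X : Finset α) : Prop :=
  X ∈ clustered K ∧ Good K X ∧ ¬ Covered Z X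

/-- The version of `Live` in which the family `K` is replaced by what is known from `Z`. -/
def LooksLive (r t : ℕ) (Z : Cover α) (X : Finset α) : Prop :=
  X.card = r ∧ ¬ Covered Z X ∧ X.card < 2 * (approxCirc t (region r Z) X).card ∧
    Xᶜ.card < 2 * (approxCocirc t (region r Z) X).card

/-- `Z` is a cover of `clustered K` that leaves uncovered only few neighbours of each member, and
only good members. -/
structure IsValid (r t : ℕ) (K : Finset (Finset α)) (Z : Cover α) : Prop where
  le_rank : 2 * t ≤ r
  le_corank : 2 * t ≤ Fintype.card α - r
  circ_mem : ∀ C ∈ Z.1, ∃ X ∈ clustered K, (circ K X).Nonempty ∧ circ K X = C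
  cocirc_mem : ∀ D ∈ Z.2.1, ∃ X ∈ clustered K, (circ K X).Nonempty ∧ cocirc K X = D
  low_mem : ∀ X ∈ Z.2.2, X ∈ clustered K ∧ circ K X = ∅
  sparse : ∀ X ∈ clustered K,
    ((X ×ˢ Xᶜ).filter fun p => swap X p.1 p.2 ∈ clustered K \ region r Z).card ≤ t
  good : ∀ X ∈ clustered K, X ∉ region r Z → Good K X

/-- Two live sets with the same circuit or the same hyperplane. -/
def Share (K : Finset (Finset α)) (Z : Cover α) (X Y : Finset α) : Prop :=
  Live K Z X ∧ Live K Z Y ∧ (circ K X = circ K Y ∨ cocirc K X = cocirc K Y)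

/-- The equivalence relation on live sets generated by sharing a circuit or a hyperplane. -/
def Linked (K : Finset (Finset α)) (Z : Cover α) : Finset α → Finset α → Prop :=
  Relation.ReflTransGen (Share K Z)

/-- The version of `Share` in which the family `K` is replaced by what is known from `Z`. -/
def Step (r t : ℕ) (Z : Cover α) (X Y : Finset α) : Prop :=
  LooksLive r t Z Y ∧
    (approxCirc t (region r Z) X ⊆ Y ∨ Disjoint Y (approxCocirc t (region r Z) X))

section

variable {K : Finset (Finset α)} {Z : Cover α} {X Y X₁ X₂ : Finset α} {e f g f₁ f₂ : α} {r t : ℕ}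

theorem mem_region : X ∈ region r Z ↔
    X.card = r ∧ (Covered Z X ∨ ∃ Y ∈ Z.2.2, X = Y ∨ Adj Y X) := by
  simp [region]

theorem Good.nonempty (h : Good K X) : (circ K X).Nonempty := by
  rw [← Finset.card_pos]
  have := h.1
  omega

theorem Linked.refl : Linked K Z X X := Relation.ReflTransGen.refl

theorem Share.symm (h : Share K Z X Y) : Share K Z Y X :=
  ⟨h.2.1, h.1, h.2.2.imp Eq.symm Eq.symm⟩

theorem Linked.symm (h : Linked K Z X Y) : Linked K Z Y X := by
  induction h with
  | refl => exact Linked.refl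
  | tail _ h ih => exact Relation.ReflTransGen.head h.symm ih

theorem Share.linked (h : Share K Z X Y) : Linked K Z X Y := Relation.ReflTransGen.single h

theorem Linked.trans {W : Finset α} (h : Linked K Z X Y) (h' : Linked K Z Y W) :
    Linked K Z X W := Relation.ReflTransGen.trans h h'

theorem Linked.live (h : Linked K Z X Y) (hX : Live K Z X) : Live K Z Y := by
  induction h with
  | refl => exact hX
  | tail _ h _ => exact h.2.1

theorem Live.mem (h : Live K Z X) : X ∈ K := (mem_clustered.1 h.1).1

theorem Live.nonempty (h : Live K Z X) : (circ K X).Nonempty := h.2.1.nonempty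

theorem IsValid.region_subset (hK : IsNonbasisFamily r K) (hZ : IsValid r t K Z) :
    region r Z ⊆ clustered K := by
  intro Y hY
  obtain ⟨hYr, (⟨C, hC, hCY⟩ | ⟨D, hD, hDY⟩) | ⟨X, hX, h⟩⟩ := mem_region.1 hY
  · obtain ⟨X, hX, hX', rfl⟩ := hZ.circ_mem C hC
    exact hK.mem_clustered_of_circ_subset hX hX' hYr hCY
  · obtain ⟨X, hX, hX', rfl⟩ := hZ.cocirc_mem D hD
    exact hK.mem_clustered_of_disjoint_cocirc hX hX' hYr hDY
  · obtain ⟨hXc, hX'⟩ := hZ.low_mem X hX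
    rcases h with rfl | h
    · exact hXc
    · exact IsNonbasisFamily.mem_clustered_of_adj_of_circ_eq_empty (mem_clustered.1 hXc).1 hX' h

theorem IsValid.row_card_le (hZ : IsValid r t K Z) (hX : X ∈ clustered K) (he : e ∈ X)
    (hec : e ∉ circ K X) : (Xᶜ.filter fun f => swap X e f ∉ region r Z).card ≤ t := by
  refine le_trans ?_ (hZ.sparse X hX)
  apply Finset.card_le_card_of_injOn (fun f => (e, f))
  · intro f hf
    simp only [Finset.coe_filter, Finset.mem_compl, Set.mem_ofPred_eq] at hf
    simp only [Finset.coe_filter, Finset.mem_product, Finset.mem_compl, Finset.mem_sdiff,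
      Set.mem_ofPred_eq]
    refine ⟨⟨he, hf.1⟩, mem_clustered_of_adj (swap_mem_of_notMem_circ he hf.1 hec)
      (mem_clustered.1 hX).1 (Adj.symm ⟨e, he, f, hf.1, rfl⟩), hf.2⟩
  · intro a _ b _ h
    exact (Prod.ext_iff.1 h).2

theorem IsValid.column_card_le (hZ : IsValid r t K Z) (hX : X ∈ clustered K) (hf : f ∉ X)
    (hfc : f ∉ cocirc K X) : (X.filter fun e => swap X e f ∉ region r Z).card ≤ t := by
  refine le_trans ?_ (hZ.sparse X hX)
  apply Finset.card_le_card_of_injOn (fun e => (e, f))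
  · intro e he
    simp only [Finset.coe_filter, Set.mem_ofPred_eq] at he
    simp only [Finset.coe_filter, Finset.mem_product, Finset.mem_compl, Finset.mem_sdiff,
      Set.mem_ofPred_eq]
    refine ⟨⟨he.1, hf⟩, mem_clustered_of_adj (swap_mem_of_notMem_cocirc he.1 hf hfc)
      (mem_clustered.1 hX).1 (Adj.symm ⟨e, he.1, f, hf, rfl⟩), he.2⟩
  · intro a _ b _ h
    exact (Prod.ext_iff.1 h).1

theorem IsValid.approxCirc_subset (hZ : IsValid r t K Z) (hX : X ∈ clustered K) :
    approxCirc t (region r Z) X ⊆ circ K X := by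
  intro e he
  obtain ⟨heX, h⟩ := Finset.mem_filter.1 he
  by_contra hec
  exact absurd (hZ.row_card_le hX heX hec) (not_le.2 h)

theorem IsValid.approxCocirc_subset (hZ : IsValid r t K Z) (hX : X ∈ clustered K) :
    approxCocirc t (region r Z) X ⊆ cocirc K X := by
  intro f hf
  obtain ⟨hfX, h⟩ := Finset.mem_filter.1 hf
  by_contra hfc
  exact absurd (hZ.column_card_le hX (Finset.mem_compl.1 hfX) hfc) (not_le.2 h)

/-- For a good set, the exchanges that remove a given `e` lead into the known non-bases with at most
`t` exceptions if `e` is outside the circuit, whereas if `e` is in the circuit every element of the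
cocircuit, hence of more than half of the complement, is an exception. -/
theorem IsValid.approx_eq (hK : IsNonbasisFamily r K) (hZ : IsValid r t K Z)
    (hX : X ∈ clustered K) (hg : Good K X) :
    approxCirc t (region r Z) X = circ K X ∧ approxCocirc t (region r Z) X = cocirc K X := by
  have hXK := (mem_clustered.1 hX).1
  have hr := hK.card_eq X hXK
  have hVK : ∀ Y ∈ region r Z, Y ∈ K := fun Y hY =>
    (mem_clustered.1 (hZ.region_subset hK hY)).1
  have h1 := hg.1
  have h2 := hg.2
  have h3 := hZ.le_rank
  have h4 := hZ.le_corank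
  rw [Finset.card_compl, hr] at h2
  rw [hr] at h1
  constructor
  · apply (hZ.approxCirc_subset hX).antisymm
    intro e he
    refine Finset.mem_filter.2 ⟨circ_subset he, ?_⟩
    have : cocirc K X ⊆ Xᶜ.filter fun f => swap X e f ∉ region r Z := by
      intro f hf
      refine Finset.mem_filter.2 ⟨Finset.mem_compl.2 (mem_cocirc.1 hf).1, fun hV => ?_⟩
      exact hK.rect X hXK e he f hf (hVK _ hV)
    have := Finset.card_le_card this
    omega
  · apply (hZ.approxCocirc_subset hX).antisymm
    intro f hf
    refine Finset.mem_filter.2 ⟨Finset.mem_compl.2 (mem_cocirc.1 hf).1, ?_⟩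
    have : circ K X ⊆ X.filter fun e => swap X e f ∉ region r Z := by
      intro e he
      refine Finset.mem_filter.2 ⟨circ_subset he, fun hV => ?_⟩
      exact hK.rect X hXK e he f hf (hVK _ hV)
    have := Finset.card_le_card this
    omega

/-- For a valid cover, whether a clustered non-basis is live can be decided from the cover. -/
theorem IsValid.looksLive_iff (hK : IsNonbasisFamily r K) (hZ : IsValid r t K Z)
    (hX : X ∈ clustered K) : LooksLive r t Z X ↔ Live K Z X := by
  constructor
  · rintro ⟨-, h2, h3, h4⟩
    have h5 := Finset.card_le_card (hZ.approxCirc_subset hX)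
    have h6 := Finset.card_le_card (hZ.approxCocirc_subset hX)
    exact ⟨hX, ⟨by omega, by omega⟩, h2⟩
  · rintro ⟨-, h2, h3⟩
    obtain ⟨h4, h5⟩ := hZ.approx_eq hK hX h2
    refine ⟨hK.card_eq X (mem_clustered.1 hX).1, h3, ?_, ?_⟩
    · rw [h4]; exact h2.1
    · rw [h5]; exact h2.2

theorem IsValid.step_iff (hK : IsNonbasisFamily r K) (hZ : IsValid r t K Z)
    (hX : Live K Z X) : Step r t Z X Y ↔ Share K Z X Y := by
  obtain ⟨h1, h2⟩ := hZ.approx_eq hK hX.1 hX.2.1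
  rw [Step, h1, h2]
  constructor
  · rintro ⟨hY, h⟩
    have hYc : Y ∈ clustered K := h.elim
      (fun h => hK.mem_clustered_of_circ_subset hX.1 hX.nonempty hY.1 h)
      (fun h => hK.mem_clustered_of_disjoint_cocirc hX.1 hX.nonempty hY.1 h)
    have hYl := (hZ.looksLive_iff hK hYc).1 hY
    refine ⟨hX, hYl, h.imp ?_ ?_⟩
    · exact fun h => (hK.circ_eq_of_circ_subset hX.mem hYl.mem hX.nonempty hYl.nonempty h).symm
    · exact fun h => (hK.cocirc_eq_of_disjoint hX.mem hYl.mem hX.nonempty hYl.nonempty h).symm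
  · rintro ⟨-, hY, h⟩
    refine ⟨(hZ.looksLive_iff hK hY.1).2 hY, h.imp ?_ ?_⟩
    · intro h; rw [h]; exact circ_subset
    · intro h; rw [h]; exact disjoint_cocirc

/-- For a valid cover, the live sets linked to `X` can be computed from the cover and `X`. -/
theorem IsValid.reflTransGen_step_iff (hK : IsNonbasisFamily r K) (hZ : IsValid r t K Z)
    (hX : Live K Z X) : Relation.ReflTransGen (Step r t Z) X Y ↔ Linked K Z X Y := by
  constructor
  · intro h
    induction h with
    | refl => exact Linked.refl
    | tail _ h ih => exact ih.trans ((hZ.step_iff hK (ih.live hX)).1 h).linked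
  · intro h
    induction h with
    | refl => exact Relation.ReflTransGen.refl
    | tail h1 h ih => exact ih.tail ((hZ.step_iff hK (Linked.live h1 hX)).2 h)

/-- Being live depends only on the circuit and on the hyperplane, one condition on each. -/
theorem IsValid.live_of_eq (hK : IsNonbasisFamily r K) (hZ : IsValid r t K Z)
    (h₁ : Live K Z X₁) (h₂ : Live K Z X₂) (hY : Y ∈ K)
    (hc : circ K Y = circ K X₁) (hd : cocirc K Y = cocirc K X₂) : Live K Z Y := by
  have hYr := hK.card_eq Y hY
  have hYn : (circ K Y).Nonempty := by rw [hc]; exact h₁.nonempty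
  have hr₁ := hK.card_eq X₁ h₁.mem
  have hr₂ := hK.card_eq X₂ h₂.mem
  refine ⟨hK.mem_clustered_of_circ_subset h₁.1 h₁.nonempty hYr (by rw [← hc]; exact circ_subset),
    ⟨?_, ?_⟩, ?_⟩
  · rw [hc, hYr, ← hr₁]; exact h₁.2.1.1
  · rw [hd, Finset.card_compl, hYr, ← hr₂, ← Finset.card_compl]; exact h₂.2.1.2
  · rintro (⟨C, hC, hCY⟩ | ⟨D, hD, hDY⟩)
    · obtain ⟨X, hX, hX', rfl⟩ := hZ.circ_mem C hC
      have := hK.circ_eq_of_circ_subset (mem_clustered.1 hX).1 hY hX' hYn hCY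
      exact h₁.2.2 (Or.inl ⟨_, hC, by rw [← this, hc]; exact circ_subset⟩)
    · obtain ⟨X, hX, hX', rfl⟩ := hZ.cocirc_mem D hD
      have := hK.cocirc_eq_of_disjoint (mem_clustered.1 hX).1 hY hX' hYn hDY
      exact h₂.2.2 (Or.inr ⟨_, hD, by rw [← this, hd]; exact disjoint_cocirc⟩)

theorem IsValid.linked_of_adj (hK : IsNonbasisFamily r K) (h₁ : Live K Z X₁)
    (h₂ : Live K Z X₂) (h : Adj X₁ X₂) : Linked K Z X₁ X₂ :=
  Share.linked ⟨h₁, h₂, (hK.circ_eq_or_cocirc_eq_of_adj h₁.mem h₂.mem h₁.nonempty h₂.nonempty h).imp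
    Eq.symm Eq.symm⟩

theorem IsValid.linked_of_adj_swap (hK : IsNonbasisFamily r K) (hZ : IsValid r t K Z)
    (h₁ : Live K Z X₁) (h₂ : Live K Z X₂) (hg : g ∈ circ K X₂) (hf : f ∉ X₂)
    (hf' : f ∉ cocirc K X₂) (h : Adj X₁ (swap X₂ g f)) : Linked K Z X₁ X₂ := by
  obtain ⟨hm, hn, hd⟩ := hK.swap_properties h₂.mem hg hf hf'
  rcases hK.circ_eq_or_cocirc_eq_of_adj h₁.mem hm h₁.nonempty hn h with hc | hc
  · have hl := hZ.live_of_eq hK h₁ h₂ hm hc hd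
    exact (Share.linked ⟨h₁, hl, Or.inl hc.symm⟩).trans (Share.linked ⟨hl, h₂, Or.inr hd⟩)
  · exact Share.linked ⟨h₁, h₂, Or.inr (by rw [← hc, hd])⟩

/-- Exchanges that remove the same element `g` from unlinked live sets never become adjacent. -/
theorem IsValid.linked_of_swap_adj_swap (hK : IsNonbasisFamily r K) (hZ : IsValid r t K Z)
    (h₁ : Live K Z X₁) (h₂ : Live K Z X₂) (hg₁ : g ∈ circ K X₁) (hg₂ : g ∈ circ K X₂)
    (hf₁ : f₁ ∉ X₁) (hf₁' : f₁ ∉ cocirc K X₁) (hf₂ : f₂ ∉ X₂) (hf₂' : f₂ ∉ cocirc K X₂)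
    (h : Adj (swap X₁ g f₁) (swap X₂ g f₂)) : Linked K Z X₁ X₂ := by
  have hsub : ∀ {X Y : Finset α} {f : α}, f ∉ cocirc K X → Y ⊆ insert f X →
      Disjoint Y (cocirc K X) := by
    intro X Y f hf hYX
    rw [Finset.disjoint_left]
    intro a ha had
    rcases Finset.mem_insert.1 (hYX ha) with rfl | ha
    · exact hf had
    · exact (mem_cocirc.1 had).1 ha
  have hg1 := circ_subset hg₁
  have hg2 := circ_subset hg₂
  obtain ⟨a, ha, b, hb, hab⟩ := h
  have hr₁ := hK.card_eq X₁ h₁.mem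
  have hr₂ := hK.card_eq X₂ h₂.mem
  have hgb : b ≠ g := by
    rintro rfl
    have : b ∈ swap X₂ b f₂ := by rw [hab]; exact mem_swap_self
    exact notMem_swap hg2 hf₂ this
  have hga : a ≠ g := by
    rintro rfl
    exact notMem_swap hg1 hf₁ ha
  -- `D` is the intersection of the cliques `X₁ + f₁` and `X₂ + f₂`.
  set D := (insert f₁ X₁).erase a with hD
  have haP : a ∈ insert f₁ X₁ := swap_subset_insert ha
  have hDr : D.card = r := by
    rw [hD, Finset.card_erase_of_mem haP, Finset.card_insert_of_notMem hf₁, hr₁]; rfl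
  have hD1 : D ⊆ insert f₁ X₁ := Finset.erase_subset _ _
  have hmem : ∀ x, x ∈ swap X₂ g f₂ ↔ x ∈ swap (swap X₁ g f₁) a b := fun x => by rw [hab]
  simp only [mem_swap] at hmem hb ha
  have hbP : b ∉ insert f₁ X₁ := by
    rw [Finset.mem_insert]; tauto
  have hP2 : insert b D = insert f₂ X₂ := by
    ext x
    simp only [hD, Finset.mem_insert, Finset.mem_erase]
    have := hmem x
    grind
  have hD2 : D ⊆ insert f₂ X₂ := by rw [← hP2]; exact Finset.subset_insert _ _
  have hDd1 := hsub hf₁' hD1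
  have hDd2 := hsub hf₂' hD2
  have hDK := hK.mem_of_disjoint_cocirc X₁ h₁.mem h₁.nonempty D hDr hDd1
  by_cases hDn : (circ K D).Nonempty
  · -- If `D` is adjacent to a basis then it spans both hyperplanes.
    exact Share.linked ⟨h₁, h₂, Or.inr (by
      rw [← hK.cocirc_eq_of_disjoint h₁.mem hDK h₁.nonempty hDn hDd1,
        ← hK.cocirc_eq_of_disjoint h₂.mem hDK h₂.nonempty hDn hDd2])⟩
  rw [Finset.not_nonempty_iff_eq_empty] at hDn
  have hf₁a : f₁ ≠ a := by
    rintro rfl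
    rw [hD, Finset.erase_insert hf₁] at hDn
    exact absurd h₁.nonempty (by rw [hDn]; simp)
  have haX : a ∈ X₁ := by
    rcases Finset.mem_insert.1 haP with h | h
    · exact absurd h.symm hf₁a
    · exact h
  have haC : a ∉ circ K X₁ := by
    intro haC
    obtain ⟨f, hf⟩ := cocirc_nonempty_iff.2 h₁.nonempty
    have hfX := (mem_cocirc.1 hf).1
    refine hK.rect X₁ h₁.mem a haC f hf ?_
    have hff : f ≠ f₁ := fun h => hf₁' (h ▸ hf)
    have : swap X₁ a f = swap D f₁ f := by
      ext x; simp only [mem_swap, hD, Finset.mem_erase, Finset.mem_insert]; grind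
    rw [this]
    apply IsNonbasisFamily.swap_mem_of_circ_eq_empty _ _ hDn
    · simp [hD, hf₁a]
    · simp [hD, hff, hfX]
  by_cases hbd : b ∈ cocirc K X₁
  · -- The set `D - f₁ + b` has the circuit of `X₁` and the hyperplane of `X₂`.
    have hbX := (mem_cocirc.1 hbd).1
    have hDf : f₁ ∈ D := by simp [hD, hf₁a]
    have hbD : b ∉ D := fun h => hbP (hD1 h)
    have hYsub : circ K X₁ ⊆ swap D f₁ b := by
      intro x hx
      have := circ_subset hx
      rw [mem_swap, hD, Finset.mem_erase, Finset.mem_insert]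
      have : x ≠ a := fun h => haC (h ▸ hx)
      have : x ≠ f₁ := fun h => hf₁ (h ▸ circ_subset hx)
      tauto
    have hYr : (swap D f₁ b).card = r := by rw [card_swap hDf hbD, hDr]
    have hYK := hK.mem_of_circ_subset X₁ h₁.mem h₁.nonempty _ hYr hYsub
    have hYn : (circ K (swap D f₁ b)).Nonempty := by
      obtain ⟨e, he⟩ := h₁.nonempty
      refine circ_nonempty_iff.2 ⟨e, hYsub he, a, ?_, ?_⟩
      · rw [mem_swap]
        have : a ≠ b := fun h => hbP (h ▸ haP)
        simp [this, hD]
      · have hea : e ≠ a := fun h => haC (h ▸ he)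
        have heX := circ_subset he
        have : swap (swap D f₁ b) e a = swap X₁ e b := by
          ext x; simp only [mem_swap, hD, Finset.mem_erase, Finset.mem_insert]
          have := hYsub he
          grind
        rw [this]
        exact hK.rect X₁ h₁.mem e he b hbd
    have hc := hK.circ_eq_of_circ_subset h₁.mem hYK h₁.nonempty hYn hYsub
    have hd := hK.cocirc_eq_of_disjoint h₂.mem hYK h₂.nonempty hYn
      (hsub hf₂' (swap_subset_insert.trans hP2.le))
    have hl := hZ.live_of_eq hK h₁ h₂ hYK hc hd
    exact (Share.linked ⟨h₁, hl, Or.inl hc.symm⟩).trans (Share.linked ⟨hl, h₂, Or.inr hd⟩)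
  · refine Share.linked ⟨h₁, h₂, Or.inr ?_⟩
    refine (hK.cocirc_eq_of_disjoint h₁.mem h₂.mem h₁.nonempty h₂.nonempty ?_).symm
    rw [Finset.disjoint_left]
    intro x hx hxd
    have : x ∈ insert b D := by rw [hP2]; exact Finset.mem_insert_of_mem hx
    rcases Finset.mem_insert.1 this with rfl | h
    · exact hbd hxd
    · exact Finset.disjoint_left.1 hDd1 h hxd

end

end

section

variable {α : Type*} [DecidableEq α] [Fintype α]

/-! ### Encoding families of non-bases as stable families -/

/-- No two members are adjacent in the Johnson graph. -/
def IsStable (T : Finset (Finset α)) : Prop := ∀ X ∈ T, ∀ Y ∈ T, ¬ Adj X Y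

variable (α) in
open Classical in
/-- The stable sets of the Johnson graph of `r`-sets. -/
noncomputable def stableFamilies (r : ℕ) : Finset (Finset (Finset α)) :=
  Finset.univ.filter fun T => (∀ X ∈ T, X.card = r) ∧ IsStable T

/-- The sets from which decoding a stable family `T` starts. A member of `T` next to the region of
`Z` represents a class of linked live sets: either it is itself in that class, or it arose from a
member of the class by an exchange that removed `g`. -/
def Seed (r t : ℕ) (Z : Cover α) (g : α) (T : Finset (Finset α)) (S : Finset α) : Prop :=
  LooksLive r t Z S ∧ ∃ X ∈ T, (∃ Y ∈ region r Z, Adj X Y) ∧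
    (S = X ∨ ¬ LooksLive r t Z X ∧ S ⊆ insert g X)

/-- The family of non-bases described by a cover `Z`, an element `g`, and a stable family `T`. -/
def decode (r t : ℕ) (Z : Cover α) (g : α) (T : Finset (Finset α)) : Set (Finset α) :=
  {Y | (Y ∈ T ∧ ¬ ∃ V ∈ region r Z, Adj Y V) ∨ Y ∈ region r Z ∨
    ∃ S, Seed r t Z g T S ∧ Relation.ReflTransGen (Step r t Z) S Y}

/-- `Q` consists of pairwise unlinked live sets that are properly contained in the hyperplane
they span. -/
def IsHyperplaneType (K : Finset (Finset α)) (Z : Cover α) (Q : Finset (Finset α)) : Prop :=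
  (∀ X ∈ Q, Live K Z X ∧ ∃ f ∉ X, f ∉ cocirc K X) ∧ ∀ X ∈ Q, ∀ Y ∈ Q, Linked K Z X Y → X = Y

section

variable {K : Finset (Finset α)} {Z : Cover α} {X Y X₁ X₂ : Finset α} {e f g f₁ f₂ : α} {r t : ℕ}

theorem mem_stableFamilies {T : Finset (Finset α)} :
    T ∈ stableFamilies α r ↔ (∀ X ∈ T, X.card = r) ∧ IsStable T := by
  simp [stableFamilies]

theorem IsValid.live_of_notMem_region (hK : IsNonbasisFamily r K) (hZ : IsValid r t K Z)
    (hX : X ∈ clustered K) (h : X ∉ region r Z) : Live K Z X :=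
  ⟨hX, hZ.good X hX h, fun hc =>
    h (mem_region.2 ⟨hK.card_eq X (mem_clustered.1 hX).1, Or.inl hc⟩)⟩

/-- A set of pairwise unlinked live sets extends to a system of representatives. -/
theorem exists_transversal (Q₀ : Finset (Finset α)) (hQ₀ : ∀ X ∈ Q₀, Live K Z X)
    (hQ₀' : ∀ X ∈ Q₀, ∀ Y ∈ Q₀, Linked K Z X Y → X = Y) :
    ∃ Q, Q₀ ⊆ Q ∧ (∀ X ∈ Q, Live K Z X) ∧ (∀ X ∈ Q, ∀ Y ∈ Q, Linked K Z X Y → X = Y) ∧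
      ∀ Y, Live K Z Y → ∃ X ∈ Q, Linked K Z X Y := by
  obtain ⟨Q, hQ, hmax⟩ := (Set.toFinite {Q : Finset (Finset α) | (∀ X ∈ Q, Live K Z X) ∧
    ∀ X ∈ Q, ∀ Y ∈ Q, Linked K Z X Y → X = Y}).exists_le_maximal (a := Q₀) ⟨hQ₀, hQ₀'⟩
  refine ⟨Q, hQ, hmax.1.1, hmax.1.2, fun Y hY => ?_⟩
  by_contra! hno
  have hins : insert Y Q ∈ {Q : Finset (Finset α) | (∀ X ∈ Q, Live K Z X) ∧
      ∀ X ∈ Q, ∀ Y ∈ Q, Linked K Z X Y → X = Y} := by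
    refine ⟨?_, ?_⟩
    · intro X hX
      rcases Finset.mem_insert.1 hX with rfl | hX
      · exact hY
      · exact hmax.1.1 X hX
    · intro X hX W hW h
      rcases Finset.mem_insert.1 hX with hX' | hX <;> rcases Finset.mem_insert.1 hW with hW' | hW
      · rw [hX', hW']
      · rw [hX'] at h
        exact absurd h.symm (hno W hW)
      · rw [hW'] at h
        exact absurd h (hno X hX)
      · exact hmax.1.2 X hX W hW h
  have := hmax.2 hins (Finset.subset_insert _ _)
  exact hno Y (this (Finset.mem_insert_self _ _)) Linked.refl

theorem IsValid.exists_column_mem_region (hK : IsNonbasisFamily r K) (hZ : IsValid r t K Z)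
    (hr : 3 ≤ r) (hX : X ∈ clustered K) (hf : f ∉ X) (hfc : f ∉ cocirc K X) (g : α) :
    ∃ e ∈ X, e ≠ g ∧ swap X e f ∈ region r Z := by
  have h1 := hZ.column_card_le hX hf hfc
  have h2 := hZ.le_rank
  by_contra! hno
  have : X.erase g ⊆ X.filter fun e => swap X e f ∉ region r Z := by
    intro e he
    rw [Finset.mem_erase] at he
    exact Finset.mem_filter.2 ⟨he.2, hno e he.2 he.1⟩
  have h3 := Finset.card_le_card this
  have h4 := Finset.pred_card_le_card_erase (s := X) (a := g)
  rw [hK.card_eq X (mem_clustered.1 hX).1] at h4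
  omega

theorem IsValid.exists_adj_region (hK : IsNonbasisFamily r K) (hZ : IsValid r t K Z)
    (hr : 3 ≤ r) (hX : X ∈ clustered K) : ∃ Y ∈ region r Z, Adj X Y := by
  obtain ⟨hXK, e, he, f, hf, hs⟩ := mem_clustered.1 hX
  by_cases hfc : f ∈ cocirc K X
  · have hec : e ∉ circ K X := fun hec => hK.rect X hXK e hec f hfc hs
    have h1 := hZ.row_card_le hX he hec
    have h2 := hZ.le_corank
    by_contra! hno
    have : Xᶜ ⊆ Xᶜ.filter fun f => swap X e f ∉ region r Z := by
      intro f hf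
      refine Finset.mem_filter.2 ⟨hf, fun h => ?_⟩
      exact hno _ h ⟨e, he, f, Finset.mem_compl.1 hf, rfl⟩
    have h3 := Finset.card_le_card this
    have h4 : 0 < Xᶜ.card := Finset.card_pos.2 ⟨f, Finset.mem_compl.2 hf⟩
    rw [Finset.card_compl, hK.card_eq X hXK] at h3 h4
    omega
  · obtain ⟨e', he', -, h⟩ := hZ.exists_column_mem_region hK hr hX hf hfc e
    exact ⟨_, h, e', he', f, hf, rfl⟩

/-- The stable family in which the representatives in `A` are exchanged, removing `g`. -/
def encode (K : Finset (Finset α)) (g : α) (φ : Finset α → α) (Q A : Finset (Finset α)) :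
    Finset (Finset α) :=
  (K \ clustered K) ∪ (Q \ A) ∪ A.image fun X => swap X g (φ X)

theorem mem_encode {φ : Finset α → α} {Q A : Finset (Finset α)} :
    X ∈ encode K g φ Q A ↔ (X ∈ K ∧ X ∉ clustered K) ∨ (X ∈ Q ∧ X ∉ A) ∨
      ∃ Y ∈ A, swap Y g (φ Y) = X := by
  simp [encode]

/-- Here `Q` is a system of representatives of all classes of linked live sets, and `φ` chooses for
each representative in `A` an element of its hyperplane. The encoding is stable because adjacent
members would come from linked representatives, and decoding it recovers `K`. -/
theorem encode_properties (hK : IsNonbasisFamily r K) (hZ : IsValid r t K Z) (hr : 3 ≤ r)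
    {Q A : Finset (Finset α)} {φ : Finset α → α} (hQ : ∀ X ∈ Q, Live K Z X)
    (hQ' : ∀ X ∈ Q, ∀ Y ∈ Q, Linked K Z X Y → X = Y)
    (hQ'' : ∀ Y, Live K Z Y → ∃ X ∈ Q, Linked K Z X Y) (hAQ : A ⊆ Q)
    (hA : ∀ X ∈ A, g ∈ circ K X ∧ φ X ∉ X ∧ φ X ∉ cocirc K X) :
    encode K g φ Q A ∈ stableFamilies α r ∧ decode r t Z g (encode K g φ Q A) = K := by
  have hprop : ∀ X ∈ A, swap X g (φ X) ∈ clustered K ∧ (circ K (swap X g (φ X))).Nonempty ∧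
      cocirc K (swap X g (φ X)) = cocirc K X := by
    intro X hX
    obtain ⟨h1, h2, h3⟩ := hA X hX
    have hl := hQ X (hAQ hX)
    obtain ⟨h4, h5, h6⟩ := hK.swap_properties hl.mem h1 h2 h3
    exact ⟨mem_clustered_of_adj h4 hl.mem
      (Adj.symm ⟨g, circ_subset h1, φ X, h2, rfl⟩), h5, h6⟩
  have hTK : ∀ X ∈ encode K g φ Q A, X ∈ K := by
    intro X hX
    rcases mem_encode.1 hX with h | h | ⟨Y, hY, rfl⟩
    · exact h.1
    · exact (hQ X h.1).mem
    · exact (mem_clustered.1 (hprop Y hY).1).1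
  have hVK : ∀ Y ∈ region r Z, Y ∈ K := fun Y hY =>
    (mem_clustered.1 (hZ.region_subset hK hY)).1
  refine ⟨mem_stableFamilies.2 ⟨fun X hX => hK.card_eq X (hTK X hX), ?_⟩, ?_⟩
  · intro X hX Y hY hadj
    have hXK := hTK X hX
    have hYK := hTK Y hY
    have hXc := mem_clustered_of_adj hXK hYK hadj
    have hYc := mem_clustered_of_adj hYK hXK hadj.symm
    rcases mem_encode.1 hX with h | ⟨h1, h2⟩ | ⟨X', hX', rfl⟩
    · exact h.2 hXc
    · rcases mem_encode.1 hY with h' | ⟨h1', h2'⟩ | ⟨Y', hY', rfl⟩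
      · exact h'.2 hYc
      · have := hQ' _ h1 _ h1' (IsValid.linked_of_adj hK (hQ _ h1) (hQ _ h1') hadj)
        subst this
        exact Adj.irrefl hadj
      · have := hQ' _ h1 _ (hAQ hY') (hZ.linked_of_adj_swap hK (hQ _ h1) (hQ _ (hAQ hY'))
          (hA _ hY').1 (hA _ hY').2.1 (hA _ hY').2.2 hadj)
        subst this
        exact h2 hY'
    · rcases mem_encode.1 hY with h' | ⟨h1', h2'⟩ | ⟨Y', hY', rfl⟩
      · exact h'.2 hYc
      · have := hQ' _ h1' _ (hAQ hX') (hZ.linked_of_adj_swap hK (hQ _ h1') (hQ _ (hAQ hX'))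
          (hA _ hX').1 (hA _ hX').2.1 (hA _ hX').2.2 hadj.symm)
        subst this
        exact h2' hX'
      · have := hQ' _ (hAQ hX') _ (hAQ hY') (hZ.linked_of_swap_adj_swap hK (hQ _ (hAQ hX'))
          (hQ _ (hAQ hY')) (hA _ hX').1 (hA _ hY').1 (hA _ hX').2.1 (hA _ hX').2.2 (hA _ hY').2.1
          (hA _ hY').2.2 hadj)
        subst this
        exact Adj.irrefl hadj
  · ext Y
    simp only [Finset.mem_coe]
    constructor
    · rintro (⟨hY, -⟩ | hY | ⟨S, ⟨hS, X, hX, ⟨V, hV, hXV⟩, hSX⟩, hSY⟩)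
      · exact hTK Y hY
      · exact hVK Y hY
      · -- A seed is clustered: it is a member of the encoding next to the region, or it lies in
        -- the hyperplane of an exchanged representative.
        have hXc := mem_clustered_of_adj (hTK X hX) (hVK V hV) hXV
        have hSc : S ∈ clustered K := by
          rcases hSX with rfl | ⟨hnl, hSX⟩
          · exact hXc
          · rcases mem_encode.1 hX with h | ⟨h1, h2⟩ | ⟨X', hX', rfl⟩
            · exact absurd hXc h.2
            · exact absurd ((hZ.looksLive_iff hK hXc).2 (hQ X h1)) hnl
            · have hl := hQ X' (hAQ hX')
              obtain ⟨hg, h1, h2⟩ := hA X' hX'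
              refine hK.mem_clustered_of_disjoint_cocirc hl.1 hl.nonempty hS.1 ?_
              rw [Finset.disjoint_left]
              intro a ha had
              have := hSX ha
              rw [Finset.mem_insert, mem_swap] at this
              rcases this with rfl | rfl | ⟨-, h⟩
              · exact (mem_cocirc.1 had).1 (circ_subset hg)
              · exact h2 had
              · exact (mem_cocirc.1 had).1 h
        have hSl := (hZ.looksLive_iff hK hSc).1 hS
        exact (((hZ.reflTransGen_step_iff hK hSl).1 hSY).live hSl).mem
    · intro hY
      by_cases hYc : Y ∈ clustered K
      · right
        by_cases hYV : Y ∈ region r Z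
        · exact Or.inl hYV
        right
        obtain ⟨X, hXQ, hXY⟩ := hQ'' Y (hZ.live_of_notMem_region hK hYc hYV)
        have hXl := hQ X hXQ
        by_cases hXA : X ∈ A
        · obtain ⟨hg, hf, hfc⟩ := hA X hXA
          obtain ⟨h1, h2, h3⟩ := hprop X hXA
          have hgX := circ_subset hg
          have hmem : swap X g (φ X) ∈ encode K g φ Q A :=
            mem_encode.2 (Or.inr (Or.inr ⟨X, hXA, rfl⟩))
          obtain ⟨e, he, heg, hV⟩ := hZ.exists_column_mem_region hK hr hXl.1 hf hfc g
          have hnb : ∃ V ∈ region r Z, Adj (swap X g (φ X)) V :=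
            ⟨_, hV, adj_swap_swap hf he hgX heg⟩
          -- The exchange changes the circuit, so the exchanged set need not be live. In that case
          -- `X` itself is a seed, as it is contained in the exchanged set with `g` added.
          by_cases hl : LooksLive r t Z (swap X g (φ X))
          · have hl' := (hZ.looksLive_iff hK h1).1 hl
            refine ⟨_, ⟨hl, _, hmem, hnb, Or.inl rfl⟩, ?_⟩
            rw [hZ.reflTransGen_step_iff hK hl']
            exact (Share.linked ⟨hl', hXl, Or.inr h3⟩).trans hXY
          · refine ⟨X, ⟨(hZ.looksLive_iff hK hXl.1).2 hXl, _, hmem, hnb, Or.inr ⟨hl, ?_⟩⟩,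
              (hZ.reflTransGen_step_iff hK hXl).2 hXY⟩
            intro a ha
            rw [Finset.mem_insert, mem_swap]
            tauto
        · exact ⟨X, ⟨(hZ.looksLive_iff hK hXl.1).2 hXl, X,
            mem_encode.2 (Or.inr (Or.inl ⟨hXQ, hXA⟩)), hZ.exists_adj_region hK hr hXl.1,
            Or.inl rfl⟩, (hZ.reflTransGen_step_iff hK hXl).2 hXY⟩
      · left
        refine ⟨mem_encode.2 (Or.inl ⟨hY, hYc⟩), ?_⟩
        rintro ⟨V, hV, hYV⟩
        exact not_adj_of_notMem_clustered hY hYc (hVK V hV) hYV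

/-- Different choices of the representatives to exchange give different stable families. -/
theorem encode_injOn (hK : IsNonbasisFamily r K)
    {Q B : Finset (Finset α)} {φ : Finset α → α} (hQ : ∀ X ∈ Q, Live K Z X)
    (hQ' : ∀ X ∈ Q, ∀ Y ∈ Q, Linked K Z X Y → X = Y) (hBQ : B ⊆ Q)
    (hB : ∀ X ∈ B, g ∈ circ K X ∧ φ X ∉ X ∧ φ X ∉ cocirc K X) :
    Set.InjOn (encode K g φ Q) (B.powerset : Finset (Finset (Finset α))) := by
  have key : ∀ A ⊆ B, ∀ X ∈ B, X ∈ A ↔ X ∉ encode K g φ Q A := by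
    intro A hA X hX
    constructor
    · intro hXA h
      rcases mem_encode.1 h with h | h | ⟨Y, hY, hYX⟩
      · exact h.2 (hQ X (hBQ hX)).1
      · exact h.2 hXA
      · obtain ⟨h1, h2, h3⟩ := hB Y (hA hY)
        have h4 := (hK.swap_properties (hQ Y (hBQ (hA hY))).mem h1 h2 h3).2.2
        rw [hYX] at h4
        have := hQ' X (hBQ hX) Y (hBQ (hA hY))
          (Share.linked ⟨hQ X (hBQ hX), hQ Y (hBQ (hA hY)), Or.inr h4⟩)
        subst this
        exact notMem_swap (circ_subset h1) h2 (hYX.symm ▸ circ_subset h1)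
    · intro h
      by_contra hXA
      exact h (mem_encode.2 (Or.inr (Or.inl ⟨hBQ hX, hXA⟩)))
  intro A hA A' hA' h
  rw [Finset.mem_coe, Finset.mem_powerset] at hA hA'
  ext X
  constructor
  · intro hX
    rw [key A' hA' X (hA hX), ← h, ← key A hA X (hA hX)]
    exact hX
  · intro hX
    rw [key A hA X (hA' hX), h, ← key A' hA' X (hA' hX)]
    exact hX

/-- Good sets have large circuits, so some element lies in the circuits of a constant proportion
of the members of `Q`. -/
theorem exists_mem_many_circ [Nonempty α] (hK : IsNonbasisFamily r K)
    (hr : Fintype.card α ≤ 4 * r) {Q : Finset (Finset α)} (hQ : ∀ X ∈ Q, Live K Z X) {q : ℕ}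
    (hq : 8 * q ≤ Q.card) : ∃ g : α, q ≤ (Q.filter fun X => g ∈ circ K X).card := by
  by_contra! hno
  have hsum : ∑ g : α, (Q.filter fun X => g ∈ circ K X).card = ∑ X ∈ Q, (circ K X).card := by
    simp only [Finset.card_filter]
    rw [Finset.sum_comm]
    refine Finset.sum_congr rfl fun X _ => ?_
    simp
  have h1 : ∑ g : α, (Q.filter fun X => g ∈ circ K X).card < ∑ _g : α, q :=
    Finset.sum_lt_sum_of_nonempty Finset.univ_nonempty fun g _ => hno g
  have h2 : Q.card * r ≤ ∑ X ∈ Q, 2 * (circ K X).card := by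
    rw [← smul_eq_mul]
    refine Finset.card_nsmul_le_sum _ _ _ fun X hX => ?_
    have := (hQ X hX).2.1.1
    rw [hK.card_eq X (hQ X hX).mem] at this
    exact this.le
  rw [← Finset.mul_sum, ← hsum] at h2
  rw [Finset.sum_const, Finset.card_univ, smul_eq_mul] at h1
  have h3 := Nat.mul_le_mul_right r hq
  have h4 := Nat.mul_le_mul_right q hr
  nlinarith

theorem exists_encodings [Nonempty α] (hK : IsNonbasisFamily r K) (hZ : IsValid r t K Z)
    (hr : 3 ≤ r) (hr' : Fintype.card α ≤ 4 * r) {Q₀ : Finset (Finset α)}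
    (hQ₀ : IsHyperplaneType K Z Q₀) {q : ℕ} (hq : 8 * q ≤ Q₀.card) :
    ∃ g : α, ∃ 𝒯 : Finset (Finset (Finset α)), 2 ^ q ≤ 𝒯.card ∧
      ∀ T ∈ 𝒯, T ∈ stableFamilies α r ∧ decode r t Z g T = K := by
  have hl : ∀ X ∈ Q₀, Live K Z X := fun X hX => (hQ₀.1 X hX).1
  obtain ⟨Q, hQ₀Q, hQ, hQ', hQ''⟩ := exists_transversal Q₀ hl hQ₀.2
  obtain ⟨g, hg⟩ := exists_mem_many_circ hK hr' hl hq
  have hex : ∀ X, ∃ f, X ∈ Q₀ → f ∉ X ∧ f ∉ cocirc K X := by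
    intro X
    by_cases hX : X ∈ Q₀
    · obtain ⟨f, hf⟩ := (hQ₀.1 X hX).2
      exact ⟨f, fun _ => hf⟩
    · exact ⟨g, fun h => absurd h hX⟩
  choose φ hφ using hex
  set B := Q₀.filter fun X => g ∈ circ K X with hBdef
  have hB : ∀ X ∈ B, g ∈ circ K X ∧ φ X ∉ X ∧ φ X ∉ cocirc K X := by
    intro X hX
    rw [hBdef, Finset.mem_filter] at hX
    exact ⟨hX.2, hφ X hX.1⟩
  have hBQ : B ⊆ Q := (Finset.filter_subset _ _).trans hQ₀Q
  refine ⟨g, B.powerset.image (encode K g φ Q), ?_, ?_⟩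
  · rw [Finset.card_image_of_injOn (encode_injOn hK hQ hQ' hBQ hB), Finset.card_powerset]
    exact Nat.pow_le_pow_right (by norm_num) hg
  · intro T hT
    obtain ⟨A, hA, rfl⟩ := Finset.mem_image.1 hT
    rw [Finset.mem_powerset] at hA
    exact encode_properties hK hZ hr hQ hQ' hQ'' (hA.trans hBQ) fun X hX => hB X (hA hX)

end

/-- Families of non-bases with a common cover and many classes of linked live sets are few compared
to stable families: each of them has many encodings, and each encoding determines the family. -/
theorem card_mul_two_pow_le [Nonempty α] {r t q : ℕ} {Z : Cover α} (hr : 3 ≤ r)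
    (hr' : Fintype.card α ≤ 4 * r) (𝒦 : Finset (Finset (Finset α)))
    (h𝒦 : ∀ K ∈ 𝒦, IsNonbasisFamily r K ∧ IsValid r t K Z ∧
      ∃ Q, IsHyperplaneType K Z Q ∧ 8 * q ≤ Q.card) :
    𝒦.card * 2 ^ q ≤ Fintype.card α * (stableFamilies α r).card := by
  have hex : ∀ K, ∃ g : α, ∃ 𝒯 : Finset (Finset (Finset α)), K ∈ 𝒦 → 2 ^ q ≤ 𝒯.card ∧
      ∀ T ∈ 𝒯, T ∈ stableFamilies α r ∧ decode r t Z g T = K := by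
    intro K
    by_cases hK : K ∈ 𝒦
    · obtain ⟨h1, h2, Q, h3, h4⟩ := h𝒦 K hK
      obtain ⟨g, 𝒯, h⟩ := exists_encodings h1 h2 hr hr' h3 h4
      exact ⟨g, 𝒯, fun _ => h⟩
    · exact ⟨Classical.arbitrary α, ∅, fun h => absurd h hK⟩
  choose g 𝒯 h using hex
  calc 𝒦.card * 2 ^ q ≤ ∑ K ∈ 𝒦, (𝒯 K).card := by
        rw [← smul_eq_mul]
        exact Finset.card_nsmul_le_sum _ _ _ fun K hK => (h K hK).1
    _ = (𝒦.sigma 𝒯).card := (Finset.card_sigma _ _).symm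
    _ ≤ (Finset.univ ×ˢ stableFamilies α r : Finset (α × Finset (Finset α))).card := by
        apply Finset.card_le_card_of_injOn fun p => (g p.1, p.2)
        · rintro ⟨K, T⟩ hp
          rw [Finset.mem_coe, Finset.mem_sigma] at hp
          simpa using ((h K hp.1).2 T hp.2).1
        · rintro ⟨K, T⟩ hp ⟨K', T'⟩ hp' heq
          rw [Finset.mem_coe, Finset.mem_sigma] at hp hp'
          obtain ⟨h1, h2⟩ := Prod.ext_iff.1 heq
          simp only at h1 h2
          subst h2
          have h3 := ((h K hp.1).2 T hp.2).2
          have h4 := ((h K' hp'.1).2 T hp'.2).2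
          rw [h1, h4] at h3
          have : K' = K := by exact_mod_cast h3
          subst this
          rfl
    _ = _ := by rw [Finset.card_product, Finset.card_univ]

end

section

/-! ### Greedy covering -/

section greedy

variable {ι β : Type*} [DecidableEq ι] [DecidableEq β]

/-- If some neighbourhood always contains a `ρ`-fraction of what is still uncovered, then the
uncovered part decays exponentially, until it has at most `m` elements. -/
theorem exists_greedy_shrink (U : Finset ι) (N : ι → Finset β) (A₀ : Finset β) (ρ m : ℝ)
    (h : ∀ A ⊆ A₀, m < A.card → ∃ y ∈ U, ρ * A.card ≤ (A ∩ N y).card) (j : ℕ) :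
    ∃ S ⊆ U, S.card ≤ j ∧ (((A₀ \ S.biUnion N).card : ℝ) ≤ m ∨
      ((A₀ \ S.biUnion N).card : ℝ) ≤ Real.exp (-(ρ * j)) * A₀.card) := by
  induction j with
  | zero => exact ⟨∅, Finset.empty_subset _, le_rfl, Or.inr (by simp)⟩
  | succ j ih =>
    obtain ⟨S, hS, hSj, hm⟩ := ih
    by_cases hle : ((A₀ \ S.biUnion N).card : ℝ) ≤ m
    · exact ⟨S, hS, by omega, Or.inl hle⟩
    have hm := hm.resolve_left hle
    obtain ⟨y, hy, hyA⟩ := h (A₀ \ S.biUnion N) Finset.sdiff_subset (not_le.1 hle)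
    refine ⟨insert y S, Finset.insert_subset hy hS, ?_, Or.inr ?_⟩
    · exact (Finset.card_insert_le _ _).trans (by omega)
    have h1 : A₀ \ (insert y S).biUnion N = (A₀ \ S.biUnion N) \ N y := by
      ext a
      simp only [Finset.biUnion_insert, Finset.mem_sdiff, Finset.mem_union]
      tauto
    have h2 := Finset.card_sdiff_add_card_inter (A₀ \ S.biUnion N) (N y)
    have h2' : (((A₀ \ S.biUnion N) \ N y).card : ℝ) + ((A₀ \ S.biUnion N) ∩ N y).card =
        (A₀ \ S.biUnion N).card := by exact_mod_cast h2
    rw [h1]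
    have h3 : (((A₀ \ S.biUnion N) \ N y).card : ℝ) ≤ (1 - ρ) * (A₀ \ S.biUnion N).card := by
      linarith
    have h4 : 1 - ρ ≤ Real.exp (-ρ) := Real.one_sub_le_exp_neg ρ
    calc (((A₀ \ S.biUnion N) \ N y).card : ℝ) ≤ (1 - ρ) * (A₀ \ S.biUnion N).card := h3
      _ ≤ Real.exp (-ρ) * (A₀ \ S.biUnion N).card := by gcongr
      _ ≤ Real.exp (-ρ) * (Real.exp (-(ρ * j)) * A₀.card) := by gcongr
      _ = Real.exp (-(ρ * (j + 1 : ℕ))) * A₀.card := by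
        rw [← mul_assoc, ← Real.exp_add]
        congr 2
        push_cast
        ring

/-- Choosing neighbourhoods with more than `t` uncovered elements, as long as there are any, leaves
at most `t` uncovered elements in each neighbourhood. -/
theorem exists_greedy_sparse (U : Finset ι) (N : ι → Finset β) (t : ℕ) (A₀ : Finset β) :
    ∃ S ⊆ U, (t + 1) * S.card ≤ A₀.card ∧ ∀ y ∈ U, ((A₀ \ S.biUnion N) ∩ N y).card ≤ t := by
  induction hn : A₀.card using Nat.strong_induction_on generalizing A₀ with
  | _ k ih =>
    by_cases hall : ∀ y ∈ U, (A₀ ∩ N y).card ≤ t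
    · exact ⟨∅, Finset.empty_subset _, by simp, by simpa using hall⟩
    push Not at hall
    obtain ⟨y, hy, hyt⟩ := hall
    have h2 := Finset.card_sdiff_add_card_inter A₀ (N y)
    obtain ⟨S, hS, hc, hs⟩ := ih (A₀ \ N y).card (by omega) (A₀ \ N y) rfl
    refine ⟨insert y S, Finset.insert_subset hy hS, ?_, ?_⟩
    · have := Finset.card_insert_le y S
      have := Nat.mul_le_mul_left (t + 1) this
      rw [mul_add, mul_one] at this
      omega
    · have : A₀ \ (insert y S).biUnion N = (A₀ \ N y) \ S.biUnion N := by
        ext a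
        simp only [Finset.biUnion_insert, Finset.mem_sdiff, Finset.mem_union]
        tauto
      rw [this]
      exact hs

end greedy

variable {α : Type*} [DecidableEq α] [Fintype α]

open Classical in
/-- The closed neighbourhood of `X` in the Johnson graph. -/
noncomputable def closedNhd (X : Finset α) : Finset (Finset α) :=
  Finset.univ.filter fun Y => Y = X ∨ Adj X Y

section

variable {K : Finset (Finset α)} {Z : Cover α} {X Y : Finset α} {r t : ℕ}

theorem mem_closedNhd : Y ∈ closedNhd X ↔ Y = X ∨ Adj X Y := by simp [closedNhd]

theorem mem_closedNhd_comm : Y ∈ closedNhd X ↔ X ∈ closedNhd Y := by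
  rw [mem_closedNhd, mem_closedNhd]
  exact or_congr eq_comm ⟨Adj.symm, Adj.symm⟩

open Classical in
theorem card_common_subsets_le (hX : X.card = r) (hY : Y.card = r) (hr : 1 ≤ r) :
    ((Finset.powersetCard (r - 1) (Finset.univ : Finset α)).filter
      fun Q => Q ⊆ X ∧ Q ⊆ Y).card ≤ (if X = Y then r else 0) + if Adj X Y then 1 else 0 := by
  have hsub : (Finset.powersetCard (r - 1) (Finset.univ : Finset α)).filter
      (fun Q => Q ⊆ X ∧ Q ⊆ Y) ⊆ Finset.powersetCard (r - 1) (X ∩ Y) := by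
    intro Q hQ
    rw [Finset.mem_filter, Finset.mem_powersetCard] at hQ
    exact Finset.mem_powersetCard.2 ⟨Finset.subset_inter hQ.2.1 hQ.2.2, hQ.1.2⟩
  refine (Finset.card_le_card hsub).trans ?_
  rw [Finset.card_powersetCard]
  by_cases h : X = Y
  · subst h
    rw [Finset.inter_self, hX]
    have : r.choose (r - 1) = r := by
      rw [Nat.choose_symm hr, Nat.choose_one_right]
    simp [this]
  · rw [if_neg h, zero_add]
    split_ifs with hadj
    · have : (X ∩ Y).card ≤ r - 1 := by
        have : (X ∩ Y).card < X.card := by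
          apply Finset.card_lt_card
          refine Finset.ssubset_iff_subset_ne.2 ⟨Finset.inter_subset_left, fun h' => ?_⟩
          rw [Finset.inter_eq_left] at h'
          exact h (Finset.eq_of_subset_of_card_le h' (by omega))
        omega
      rcases this.lt_or_eq with h' | h'
      · rw [Nat.choose_eq_zero_of_lt h']; omega
      · rw [h', Nat.choose_self]
    · rw [Nat.le_zero]
      apply Nat.choose_eq_zero_of_lt
      by_contra h'
      exact hadj (adj_of_le_card_inter hX hY h (not_lt.1 h'))

open Classical in
/-- Supersaturation in the Johnson graph: counting the members of `A` above each `(r-1)`-set shows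
that a dense family `A` induces a subgraph of large degree. -/
theorem exists_large_degree {A : Finset (Finset α)} (hA : ∀ X ∈ A, X.card = r) (hA' : A.Nonempty)
    (hr : 1 ≤ r) (hrn : r ≤ Fintype.card α) : ∃ X ∈ A,
      r * (Fintype.card α - r + 1) * A.card ≤
        ((A.filter fun Y => Adj X Y).card + r) * (Fintype.card α).choose r := by
  set n := Fintype.card α
  set P := Finset.powersetCard (r - 1) (Finset.univ : Finset α) with hP
  have hPcard : P.card * (n - r + 1) = n.choose r * r := by
    rw [hP, Finset.card_powersetCard, Finset.card_univ]
    have := Nat.choose_succ_right_eq n (r - 1)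
    rw [show r - 1 + 1 = r by omega, show n - (r - 1) = n - r + 1 by omega] at this
    exact this.symm
  have hsum1 : ∑ Q ∈ P, (A.filter fun X => Q ⊆ X).card = A.card * r := by
    simp only [Finset.card_filter]
    rw [Finset.sum_comm, ← smul_eq_mul, ← Finset.sum_const]
    refine Finset.sum_congr rfl fun X hX => ?_
    rw [← Finset.card_filter]
    have : P.filter (fun Q => Q ⊆ X) = Finset.powersetCard (r - 1) X := by
      ext Q
      simp only [hP, Finset.mem_filter, Finset.mem_powersetCard, Finset.subset_univ, true_and]
      tauto
    rw [this, Finset.card_powersetCard, hA X hX, Nat.choose_symm hr, Nat.choose_one_right]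
  -- The squares count the pairs in `A` with a common `(r - 1)`-subset `Q`: a pair `X = X` has `r`
  -- such subsets, an adjacent pair has one.
  have hsum2 : ∑ Q ∈ P, (A.filter fun X => Q ⊆ X).card ^ 2 ≤
      ∑ X ∈ A, ((A.filter fun Y => Adj X Y).card + r) := by
    have : ∀ Q, (A.filter fun X => Q ⊆ X).card ^ 2 =
        ∑ X ∈ A, ∑ Y ∈ A, if Q ⊆ X ∧ Q ⊆ Y then 1 else 0 := by
      intro Q
      rw [sq, Finset.card_filter, Finset.sum_mul_sum]
      refine Finset.sum_congr rfl fun X _ => Finset.sum_congr rfl fun Y _ => ?_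
      split_ifs <;> simp_all
    simp only [this]
    rw [Finset.sum_comm]
    refine Finset.sum_le_sum fun X hX => ?_
    rw [Finset.sum_comm]
    calc ∑ Y ∈ A, ∑ Q ∈ P, (if Q ⊆ X ∧ Q ⊆ Y then 1 else 0)
        ≤ ∑ Y ∈ A, ((if X = Y then r else 0) + if Adj X Y then 1 else 0) := by
          refine Finset.sum_le_sum fun Y hY => ?_
          rw [← Finset.card_filter]
          exact card_common_subsets_le (hA X hX) (hA Y hY) hr
      _ = _ := by
          rw [Finset.sum_add_distrib, Finset.sum_ite_eq, if_pos hX, ← Finset.card_filter, add_comm]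
  have hcs : (A.card * r) ^ 2 ≤ P.card * ∑ X ∈ A, ((A.filter fun Y => Adj X Y).card + r) := by
    rw [← hsum1]
    exact sq_sum_le_card_mul_sum_sq.trans (Nat.mul_le_mul_left _ hsum2)
  by_contra! hno
  have h1 : (∑ X ∈ A, ((A.filter fun Y => Adj X Y).card + r)) * n.choose r <
      A.card * (r * (n - r + 1) * A.card) := by
    rw [Finset.sum_mul, ← smul_eq_mul (a := A.card), ← Finset.sum_const]
    exact Finset.sum_lt_sum_of_nonempty hA' hno
  have h2 := Nat.mul_le_mul_right (n - r + 1) hcs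
  have h3 : P.card * (∑ X ∈ A, ((A.filter fun Y => Adj X Y).card + r)) * (n - r + 1) =
      r * ((∑ X ∈ A, ((A.filter fun Y => Adj X Y).card + r)) * n.choose r) := by
    calc _ = (P.card * (n - r + 1)) * (∑ X ∈ A, ((A.filter fun Y => Adj X Y).card + r)) := by ring
      _ = _ := by rw [hPcard]; ring
  rw [h3] at h2
  have h4 := Nat.mul_lt_mul_of_pos_left h1 (show 0 < r by omega)
  have h5 : (A.card * r) ^ 2 * (n - r + 1) = r * (A.card * (r * (n - r + 1) * A.card)) := by ring
  omega

/-- A bad member of `clustered K` is adjacent to many members of `clustered K`. -/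
theorem IsNonbasisFamily.le_card_inter_closedNhd (hK : IsNonbasisFamily r K)
    (hX : X ∈ clustered K) (hg : ¬ Good K X) :
    r * (Fintype.card α - r) ≤ 2 * (clustered K ∩ closedNhd X).card := by
  have hXK := (mem_clustered.1 hX).1
  have hXr := hK.card_eq X hXK
  have h1 : ((X ×ˢ Xᶜ) \ (circ K X ×ˢ cocirc K X)).card ≤ (clustered K ∩ closedNhd X).card := by
    apply Finset.card_le_card_of_injOn fun p => swap X p.1 p.2
    · rintro ⟨e, f⟩ hp
      simp only [Finset.coe_sdiff, Finset.coe_product, Set.mem_sdiff, Set.mem_prod, Finset.mem_coe,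
        Finset.mem_compl] at hp
      obtain ⟨⟨he, hf⟩, hn⟩ := hp
      have hadj : Adj X (swap X e f) := ⟨e, he, f, hf, rfl⟩
      have hs : swap X e f ∈ K := by
        by_contra h
        exact hn ((hK.swap_notMem_iff hXK he hf).1 h)
      simp only [Finset.coe_inter, Set.mem_inter_iff, Finset.mem_coe]
      exact ⟨mem_clustered_of_adj hs hXK hadj.symm, mem_closedNhd.2 (Or.inr hadj)⟩
    · exact (swap_injOn X).mono (by
        intro p hp
        exact Finset.sdiff_subset (Finset.mem_coe.1 hp))
  have h2 : ((X ×ˢ Xᶜ) \ (circ K X ×ˢ cocirc K X)).card + (circ K X).card * (cocirc K X).card =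
      r * (Fintype.card α - r) := by
    rw [← Finset.card_product, Finset.card_sdiff_add_card_eq_card, Finset.card_product,
      Finset.card_compl, hXr]
    refine Finset.product_subset_product circ_subset ?_
    intro f hf
    exact Finset.mem_compl.2 (mem_cocirc.1 hf).1
  have h3 : 2 * ((circ K X).card * (cocirc K X).card) ≤ r * (Fintype.card α - r) := by
    have hc := Finset.card_le_card (circ_subset (K := K) (X := X))
    have hd : (cocirc K X).card ≤ Xᶜ.card :=
      Finset.card_le_card fun f hf => Finset.mem_compl.2 (mem_cocirc.1 hf).1
    rw [Good, not_and_or, not_lt, not_lt] at hg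
    rw [Finset.card_compl] at hg hd
    rw [hXr] at hg hc hd
    rcases hg with h | h
    · calc 2 * ((circ K X).card * (cocirc K X).card)
          = (2 * (circ K X).card) * (cocirc K X).card := by ring
        _ ≤ _ := Nat.mul_le_mul h hd
    · calc 2 * ((circ K X).card * (cocirc K X).card)
          = (circ K X).card * (2 * (cocirc K X).card) := by ring
        _ ≤ _ := Nat.mul_le_mul hc h
  omega

open Classical in
/-- The cover consisting of the circuits and hyperplanes of the members of `S`. -/
noncomputable def coverOf (K S : Finset (Finset α)) : Cover α :=
  ((S.filter fun X => (circ K X).Nonempty).image (circ K),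
    (S.filter fun X => (circ K X).Nonempty).image (cocirc K), S.filter fun X => circ K X = ∅)

/-- A family whose closed neighbourhoods contain all bad sets, and leave few neighbours of any
member of `clustered K` uncovered, gives rise to a valid cover. -/
theorem isValid_coverOf (hK : IsNonbasisFamily r K) {S : Finset (Finset α)}
    (hS : S ⊆ clustered K) (ht : 2 * t ≤ r) (ht' : 2 * t ≤ Fintype.card α - r)
    (hs : ∀ X ∈ clustered K, ((clustered K \ S.biUnion closedNhd) ∩ closedNhd X).card ≤ t)
    (hg : ∀ X ∈ clustered K, ¬ Good K X → X ∈ S.biUnion closedNhd) :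
    IsValid r t K (coverOf K S) := by
  have hcov : ∀ X ∈ clustered K, X ∈ S.biUnion closedNhd → X ∈ region r (coverOf K S) := by
    intro Y hY hYS
    obtain ⟨X, hX, hXY⟩ := Finset.mem_biUnion.1 hYS
    have hYK := (mem_clustered.1 hY).1
    have hXK := (mem_clustered.1 (hS hX)).1
    refine mem_region.2 ⟨hK.card_eq Y hYK, ?_⟩
    by_cases hn : (circ K X).Nonempty
    · left
      have hc : circ K X ∈ (coverOf K S).1 :=
        Finset.mem_image.2 ⟨X, Finset.mem_filter.2 ⟨hX, hn⟩, rfl⟩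
      have hd : cocirc K X ∈ (coverOf K S).2.1 :=
        Finset.mem_image.2 ⟨X, Finset.mem_filter.2 ⟨hX, hn⟩, rfl⟩
      rcases mem_closedNhd.1 hXY with rfl | ⟨e, he, f, hf, rfl⟩
      · exact Or.inl ⟨_, hc, circ_subset⟩
      · by_cases hec : e ∈ circ K X
        · refine Or.inr ⟨_, hd, ?_⟩
          rw [Finset.disjoint_left]
          intro a ha had
          rcases mem_swap.1 ha with rfl | ⟨-, ha⟩
          · exact hK.rect X hXK e hec a had hYK
          · exact (mem_cocirc.1 had).1 ha
        · refine Or.inl ⟨_, hc, ?_⟩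
          intro a ha
          rw [mem_swap]
          exact Or.inr ⟨fun h => hec (h ▸ ha), circ_subset ha⟩
    · right
      rw [Finset.not_nonempty_iff_eq_empty] at hn
      exact ⟨X, Finset.mem_filter.2 ⟨hX, hn⟩, mem_closedNhd.1 hXY⟩
  constructor
  · exact ht
  · exact ht'
  · intro C hC
    obtain ⟨X, hX, rfl⟩ := Finset.mem_image.1 hC
    rw [Finset.mem_filter] at hX
    exact ⟨X, hS hX.1, hX.2, rfl⟩
  · intro C hC
    obtain ⟨X, hX, rfl⟩ := Finset.mem_image.1 hC
    rw [Finset.mem_filter] at hX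
    exact ⟨X, hS hX.1, hX.2, rfl⟩
  · intro X hX
    have hX := Finset.mem_filter.1 hX
    exact ⟨hS hX.1, hX.2⟩
  · intro X hX
    refine le_trans ?_ (hs X hX)
    apply Finset.card_le_card_of_injOn fun p => swap X p.1 p.2
    · rintro ⟨e, f⟩ hp
      rw [Finset.mem_coe, Finset.mem_filter, Finset.mem_product, Finset.mem_compl,
        Finset.mem_sdiff] at hp
      obtain ⟨⟨he, hf⟩, h1, h2⟩ := hp
      rw [Finset.mem_coe, Finset.mem_inter, Finset.mem_sdiff]
      exact ⟨⟨h1, fun h => h2 (hcov _ h1 h)⟩, mem_closedNhd.2 (Or.inr ⟨e, he, f, hf, rfl⟩)⟩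
    · exact (swap_injOn X).mono fun p hp => Finset.filter_subset _ _ (Finset.mem_coe.1 hp)
  · intro X hX hXV
    by_contra h
    exact hXV (hcov X hX (hg X hX h))

theorem card_coverOf_le {S : Finset (Finset α)} : (coverOf K S).1.card ≤ S.card ∧
    (coverOf K S).2.1.card ≤ S.card ∧ (coverOf K S).2.2.card ≤ S.card :=
  ⟨Finset.card_image_le.trans (Finset.card_filter_le _ _),
    Finset.card_image_le.trans (Finset.card_filter_le _ _), Finset.card_filter_le _ _⟩

end

end

section

/-! ### Existence of small covers -/

variable {α : Type*} [DecidableEq α] [Fintype α]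
variable {K : Finset (Finset α)} {Z : Cover α} {X Y : Finset α} {r t : ℕ}

/-- Every family of non-bases of middle rank has a valid cover of size `O(N log n / n ^ 2)`, where
`N` is the number of `r`-sets. -/
theorem exists_isValid (hK : IsNonbasisFamily r K) (hn : 1 ≤ Fintype.card α)
    (hr1 : Fintype.card α ≤ 4 * r) (hr2 : 4 * r ≤ 3 * Fintype.card α) {κ : ℝ}
    (hκ : (43 * Real.log (Fintype.card α) + 81) * (Fintype.card α).choose r /
      (Fintype.card α : ℝ) ^ 2 + 2 ≤ κ) :
    ∃ Z : Cover α, IsValid r (Fintype.card α / 10) K Z ∧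
      (Z.1.card : ℝ) ≤ κ ∧ (Z.2.1.card : ℝ) ≤ κ ∧ (Z.2.2.card : ℝ) ≤ κ := by
  classical
  set n := Fintype.card α with hndef
  set U := clustered K with hU
  have hn0 : (0 : ℝ) < n := by exact_mod_cast hn
  have hrn : r ≤ n := by omega
  have hN0 : 0 < n.choose r := Nat.choose_pos hrn
  set N : ℝ := (n.choose r : ℝ) with hN
  have hN0' : 0 < N := by rw [hN]; exact_mod_cast hN0
  have hUr : ∀ X ∈ U, X.card = r := fun X hX => hK.card_eq X (mem_clustered.1 hX).1
  have hUN : (U.card : ℝ) ≤ N := by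
    have : U ⊆ Finset.powersetCard r Finset.univ := fun X hX =>
      Finset.mem_powersetCard.2 ⟨Finset.subset_univ _, hUr X hX⟩
    have := Finset.card_le_card this
    rw [Finset.card_powersetCard, Finset.card_univ] at this
    rw [hN]
    exact_mod_cast this
  have hr1' : (n : ℝ) ≤ 4 * r := by exact_mod_cast hr1
  have hr2' : (n : ℝ) ≤ 4 * (n - r : ℕ) := by
    have : n ≤ 4 * (n - r) := by omega
    exact_mod_cast this
  have hsub : ((n - r : ℕ) : ℝ) = n - r := by rw [Nat.cast_sub hrn]
  have hprod : 3 * (n : ℝ) ^ 2 / 16 ≤ r * ((n - r : ℕ) : ℝ) := by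
    rw [hsub] at hr2' ⊢
    nlinarith [mul_nonneg (sub_nonneg.2 hr1') (sub_nonneg.2 hr2')]
  -- `ρ` is half of `r (n - r) / N` at the extreme ranks, and `j` greedy steps shrink a family by a
  -- factor of `n ^ 2`.
  set ρ : ℝ := 3 * n ^ 2 / (32 * N) with hρ
  set j : ℕ := ⌈64 / 3 * N * Real.log n / n ^ 2⌉₊ with hj
  have hlog : 0 ≤ Real.log n := Real.log_nonneg (by exact_mod_cast hn)
  have hjle : (j : ℝ) ≤ 64 / 3 * N * Real.log n / n ^ 2 + 1 :=
    (Nat.ceil_lt_add_one (by positivity)).le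
  have hρj : 2 * Real.log n ≤ ρ * j := by
    calc 2 * Real.log n = ρ * (64 / 3 * N * Real.log n / n ^ 2) := by
          rw [hρ]; field_simp; ring
      _ ≤ ρ * j := by
          have := Nat.le_ceil (64 / 3 * N * Real.log n / n ^ 2)
          gcongr
  have hexp : ∀ A ⊆ U, Real.exp (-(ρ * j)) * (A.card : ℝ) ≤ N / n ^ 2 := by
    intro A hA
    have h1 : Real.exp (-(ρ * j)) ≤ 1 / n ^ 2 := by
      calc Real.exp (-(ρ * j)) ≤ Real.exp (-(2 * Real.log n)) := Real.exp_le_exp.2 (by linarith)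
        _ = 1 / n ^ 2 := by
          rw [Real.exp_neg, two_mul, Real.exp_add, Real.exp_log hn0]
          field_simp
    have h2 : (A.card : ℝ) ≤ N := le_trans (by exact_mod_cast Finset.card_le_card hA) hUN
    calc Real.exp (-(ρ * j)) * (A.card : ℝ) ≤ 1 / n ^ 2 * N := by gcongr
      _ = N / n ^ 2 := by ring
  -- Supersaturation reduces the uncovered part to `O(N / n)` sets.
  obtain ⟨S₁, hS₁, hS₁j, hS₁c⟩ := exists_greedy_shrink U closedNhd U ρ (8 * N / n) (by
    intro A hA hm
    have hA0 : 0 < (A.card : ℝ) := lt_of_le_of_lt (by positivity) hm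
    obtain ⟨X, hX, h⟩ := exists_large_degree (fun X hX => hUr X (hA hX))
      (Finset.card_pos.1 (by exact_mod_cast hA0)) (by omega) hrn
    refine ⟨X, hA hX, ?_⟩
    have h1 : (A.filter fun Y => Adj X Y).card ≤ (A ∩ closedNhd X).card := by
      apply Finset.card_le_card
      intro Y hY
      rw [Finset.mem_filter] at hY
      exact Finset.mem_inter.2 ⟨hY.1, mem_closedNhd.2 (Or.inr hY.2)⟩
    have h2 : (r : ℝ) * ((n - r : ℕ) + 1) * A.card ≤ ((A ∩ closedNhd X).card + r) * N := by
      have := h.trans (Nat.mul_le_mul_right _ (Nat.add_le_add_right h1 r))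
      rw [hN]
      exact_mod_cast this
    have h3 : 2 * N ≤ ((n - r : ℕ) : ℝ) * A.card := by
      rw [div_lt_iff₀ hn0] at hm
      nlinarith [mul_le_mul_of_nonneg_right hr2' hA0.le]
    have h4 : (r : ℝ) * (2 * N) ≤ r * (((n - r : ℕ) : ℝ) * A.card) := by gcongr
    have h5 : 3 * (n : ℝ) ^ 2 / 16 * A.card ≤ r * ((n - r : ℕ) : ℝ) * A.card := by gcongr
    have h6 : 0 ≤ (r : ℝ) * A.card := by positivity
    rw [hρ, div_mul_eq_mul_div, div_le_iff₀ (by positivity)]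
    nlinarith) j
  have hc1 : ((U \ S₁.biUnion closedNhd).card : ℝ) ≤ 8 * N / n := by
    rcases hS₁c with h | h
    · exact h
    · refine h.trans ((hexp U le_rfl).trans ?_)
      rw [div_le_div_iff₀ (by positivity) hn0]
      have : (1 : ℝ) ≤ n := by exact_mod_cast hn
      nlinarith [mul_pos hN0' hn0, mul_nonneg (mul_pos hN0' hn0).le (sub_nonneg.2 this)]
  -- Of the remaining sets, few neighbourhoods can have more than `n / 10` elements.
  obtain ⟨S₂, hS₂, hS₂c, hS₂s⟩ :=
    exists_greedy_sparse U closedNhd (n / 10) (U \ S₁.biUnion closedNhd)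
  have hS₂le : (S₂.card : ℝ) ≤ 80 * N / n ^ 2 := by
    have h1 : ((n / 10 : ℕ) + 1 : ℝ) * S₂.card ≤ 8 * N / n := by
      refine le_trans ?_ hc1
      exact_mod_cast hS₂c
    have h2 : (n : ℝ) / 10 ≤ (n / 10 : ℕ) + 1 := by
      have : n ≤ 10 * (n / 10 + 1) := by omega
      have : (n : ℝ) ≤ 10 * ((n / 10 : ℕ) + 1) := by exact_mod_cast this
      linarith
    have h3 : (n : ℝ) / 10 * S₂.card ≤ 8 * N / n :=
      le_trans (mul_le_mul_of_nonneg_right h2 (by positivity)) h1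
    rw [le_div_iff₀ hn0] at h3
    rw [le_div_iff₀ (by positivity)]
    nlinarith
  -- Bad sets have so many neighbours that few sets dominate them all.
  set B := U.filter fun X => ¬ Good K X with hB
  have hBU : B ⊆ U := Finset.filter_subset _ _
  obtain ⟨S₃, hS₃, hS₃j, hS₃c⟩ := exists_greedy_shrink U closedNhd B ρ 0 (by
    intro A hA hm
    have hA0 : A.Nonempty := Finset.card_pos.1 (by exact_mod_cast hm)
    have hU0 : U.Nonempty := hA0.mono (hA.trans hBU)
    -- Double counting of the adjacent pairs between `A` and `U`.
    have hsum : ∑ y ∈ U, (A ∩ closedNhd y).card = ∑ X ∈ A, (U ∩ closedNhd X).card := by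
      simp only [← Finset.filter_mem_eq_inter, Finset.card_filter]
      rw [Finset.sum_comm]
      simp only [mem_closedNhd_comm]
    by_contra! hno
    have h1 : ∑ y ∈ U, ((A ∩ closedNhd y).card : ℝ) < ∑ _y ∈ U, ρ * A.card :=
      Finset.sum_lt_sum_of_nonempty hU0 hno
    have h2 : ∑ _X ∈ A, (r * ((n - r : ℕ) : ℝ)) / 2 ≤ ∑ X ∈ A, ((U ∩ closedNhd X).card : ℝ) := by
      refine Finset.sum_le_sum fun X hX => ?_
      obtain ⟨hXU, hXg⟩ := Finset.mem_filter.1 (hA hX)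
      have := hK.le_card_inter_closedNhd hXU hXg
      have : (r * ((n - r : ℕ) : ℝ)) ≤ 2 * (U ∩ closedNhd X).card := by exact_mod_cast this
      linarith
    have h3 : ∑ y ∈ U, ((A ∩ closedNhd y).card : ℝ) = ∑ X ∈ A, ((U ∩ closedNhd X).card : ℝ) := by
      exact_mod_cast hsum
    rw [Finset.sum_const, nsmul_eq_mul] at h1 h2
    have h4 : (U.card : ℝ) * (ρ * A.card) ≤ N * (ρ * A.card) := by gcongr
    have h5 : N * (ρ * A.card) = A.card * (3 * n ^ 2 / 16 / 2) := by
      rw [hρ]; field_simp; norm_num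
    have h6 : (A.card : ℝ) * (3 * n ^ 2 / 16 / 2) ≤ A.card * (r * ((n - r : ℕ) : ℝ) / 2) := by
      gcongr
    linarith) j
  have hc3 : ((B \ S₃.biUnion closedNhd).card : ℝ) ≤ N / n ^ 2 := by
    rcases hS₃c with h | h
    · exact h.trans (by positivity)
    · exact h.trans (hexp B hBU)
  set S := S₁ ∪ S₂ ∪ S₃ ∪ (B \ S₃.biUnion closedNhd) with hS
  have hScard : (S.card : ℝ) ≤ κ := by
    have h1 : S.card ≤ S₁.card + S₂.card + S₃.card + (B \ S₃.biUnion closedNhd).card := by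
      refine (Finset.card_union_le _ _).trans (Nat.add_le_add_right ?_ _)
      refine (Finset.card_union_le _ _).trans (Nat.add_le_add_right ?_ _)
      exact Finset.card_union_le _ _
    have h1' : (S.card : ℝ) ≤ S₁.card + S₂.card + S₃.card + (B \ S₃.biUnion closedNhd).card := by
      exact_mod_cast h1
    have h2 : (S₁.card : ℝ) ≤ j := by exact_mod_cast hS₁j
    have h3 : (S₃.card : ℝ) ≤ j := by exact_mod_cast hS₃j
    refine le_trans ?_ hκ
    have h4 : 64 / 3 * N * Real.log n / n ^ 2 + 1 + 80 * N / n ^ 2 +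
        (64 / 3 * N * Real.log n / n ^ 2 + 1) + N / n ^ 2 ≤
        (43 * Real.log n + 81) * N / n ^ 2 + 2 := by
      have h5 : 0 ≤ N * Real.log n / n ^ 2 := by positivity
      have : (43 * Real.log n + 81) * N / n ^ 2 =
        43 * (N * Real.log n / n ^ 2) + 80 * N / n ^ 2 + N / n ^ 2 := by ring
      rw [this]
      have : 64 / 3 * N * Real.log n / n ^ 2 = 64 / 3 * (N * Real.log n / n ^ 2) := by ring
      rw [this]
      linarith
    linarith
  have hSU : S ⊆ U := by
    intro X hX
    simp only [hS, Finset.mem_union] at hX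
    rcases hX with ((h | h) | h) | h
    · exact hS₁ h
    · exact hS₂ h
    · exact hS₃ h
    · exact hBU (Finset.sdiff_subset h)
  have hmono : ∀ S' ⊆ S, S'.biUnion closedNhd ⊆ S.biUnion closedNhd := fun S' h =>
    Finset.biUnion_subset_biUnion_of_subset_left _ h
  have hsub1 : S₁ ⊆ S := fun X h => by simp [hS, h]
  have hsub2 : S₂ ⊆ S := fun X h => by simp [hS, h]
  have hsub3 : S₃ ⊆ S := fun X h => by simp [hS, h]
  have hval : IsValid r (n / 10) K (coverOf K S) := by
    refine isValid_coverOf hK hSU (by omega) (by omega) ?_ ?_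
    · intro X hX
      refine le_trans (Finset.card_le_card ?_) (hS₂s X hX)
      apply Finset.inter_subset_inter_right
      intro Y hY
      rw [Finset.mem_sdiff] at hY
      rw [Finset.mem_sdiff, Finset.mem_sdiff]
      exact ⟨⟨hY.1, fun h => hY.2 (hmono _ hsub1 h)⟩, fun h => hY.2 (hmono _ hsub2 h)⟩
    · intro X hX hXg
      by_cases h : X ∈ S₃.biUnion closedNhd
      · exact hmono _ hsub3 h
      · refine Finset.mem_biUnion.2 ⟨X, ?_, mem_closedNhd.2 (Or.inl rfl)⟩
        simp only [hS, Finset.mem_union]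
        exact Or.inr (Finset.mem_sdiff.2 ⟨Finset.mem_filter.2 ⟨hX, hXg⟩, h⟩)
  obtain ⟨h1, h2, h3⟩ := card_coverOf_le (K := K) (S := S)
  refine ⟨coverOf K S, hval, ?_, ?_, ?_⟩
  · exact le_trans (by exact_mod_cast h1) hScard
  · exact le_trans (by exact_mod_cast h2) hScard
  · exact le_trans (by exact_mod_cast h3) hScard

end

section

variable {α : Type*} [DecidableEq α] [Fintype α]

/-! ### Duality for covers -/

/-- The cover of the complements. -/
def Cover.dual (Z : Cover α) : Cover α := (Z.2.1, Z.1, Z.2.2ᶜˢ)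

/-- `Q` consists of pairwise unlinked live sets that properly contain their circuit. -/
def IsCircuitType (K : Finset (Finset α)) (Z : Cover α) (Q : Finset (Finset α)) : Prop :=
  (∀ X ∈ Q, Live K Z X ∧ ∃ e ∈ X, e ∉ circ K X) ∧ ∀ X ∈ Q, ∀ Y ∈ Q, Linked K Z X Y → X = Y

section

variable {K : Finset (Finset α)} {Z : Cover α} {X Y : Finset α} {r t : ℕ}

theorem covered_dual : Covered Z.dual Xᶜ ↔ Covered Z X := by
  have h1 : ∀ C : Finset α, C ⊆ Xᶜ ↔ Disjoint X C := fun C => by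
    rw [Finset.subset_compl_comm, Finset.disjoint_left]
    simp only [Finset.subset_iff, Finset.mem_compl]
  have h2 : ∀ D : Finset α, Disjoint Xᶜ D ↔ D ⊆ X := fun D => by
    rw [Finset.disjoint_right]
    simp only [Finset.subset_iff, Finset.mem_compl, not_not]
  simp only [Covered, Cover.dual, h1, h2]
  exact or_comm

theorem region_dual (hr : r ≤ Fintype.card α) :
    region (Fintype.card α - r) Z.dual = (region r Z)ᶜˢ := by
  ext X
  obtain ⟨X, rfl⟩ : ∃ W, X = Wᶜ := ⟨Xᶜ, by simp⟩
  rw [Finset.mem_compls, compl_compl, mem_region, mem_region, covered_dual, Finset.card_compl]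
  have := Finset.card_le_univ X
  refine and_congr (by omega) (or_congr Iff.rfl ?_)
  simp only [Cover.dual, Finset.mem_compls]
  constructor
  · rintro ⟨Y, hY, h⟩
    refine ⟨Yᶜ, hY, ?_⟩
    exact h.imp (fun h => by rw [← h, compl_compl]) (fun h => by simpa using h.compl)
  · rintro ⟨Y, hY, h⟩
    refine ⟨Yᶜ, by simpa using hY, h.imp (fun h => by rw [h]) Adj.compl⟩

theorem good_compls : Good Kᶜˢ Xᶜ ↔ Good K X := by
  rw [Good, Good, circ_compls, cocirc_compls, compl_compl]
  exact and_comm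

theorem live_dual : Live Kᶜˢ Z.dual Xᶜ ↔ Live K Z X := by
  rw [Live, Live, good_compls, covered_dual, clustered_compls, Finset.mem_compls, compl_compl]

theorem share_dual (h : Share K Z X Y) : Share Kᶜˢ Z.dual Xᶜ Yᶜ :=
  ⟨live_dual.2 h.1, live_dual.2 h.2.1, by
    rw [circ_compls, circ_compls, cocirc_compls, cocirc_compls]
    exact h.2.2.symm⟩

theorem Cover.dual_dual : Z.dual.dual = Z := by
  simp [Cover.dual]

theorem share_of_dual (h : Share Kᶜˢ Z.dual X Y) : Share K Z Xᶜ Yᶜ := by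
  have := share_dual h
  rwa [Finset.compls_compls, Cover.dual_dual] at this

theorem linked_of_dual (h : Linked Kᶜˢ Z.dual X Y) : Linked K Z Xᶜ Yᶜ := by
  induction h with
  | refl => exact Linked.refl
  | tail _ h ih => exact ih.trans (share_of_dual h).linked

theorem IsCircuitType.dual {Q : Finset (Finset α)} (hQ : IsCircuitType K Z Q) :
    IsHyperplaneType Kᶜˢ Z.dual Qᶜˢ := by
  refine ⟨fun X hX => ?_, fun X hX Y hY h => ?_⟩
  · obtain ⟨X, rfl⟩ : ∃ W, X = Wᶜ := ⟨Xᶜ, by simp⟩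
    rw [Finset.mem_compls, compl_compl] at hX
    obtain ⟨hl, e, he, hec⟩ := hQ.1 X hX
    refine ⟨live_dual.2 hl, e, by simpa using he, ?_⟩
    rwa [cocirc_compls]
  · exact compl_injective
      (hQ.2 _ (Finset.mem_compls.1 hX) _ (Finset.mem_compls.1 hY) (linked_of_dual h))

theorem IsValid.dual (hr : r ≤ Fintype.card α) (hZ : IsValid r t K Z) :
    IsValid (Fintype.card α - r) t Kᶜˢ Z.dual where
  le_rank := hZ.le_corank
  le_corank := by
    have := hZ.le_rank
    omega
  circ_mem C hC := by
    obtain ⟨X, hX, hX', rfl⟩ := hZ.cocirc_mem C hC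
    refine ⟨Xᶜ, by simpa [clustered_compls] using hX, ?_, circ_compls⟩
    rw [circ_compls]
    exact cocirc_nonempty_iff.2 hX'
  cocirc_mem C hC := by
    obtain ⟨X, hX, hX', rfl⟩ := hZ.circ_mem C hC
    refine ⟨Xᶜ, by simpa [clustered_compls] using hX, ?_, cocirc_compls⟩
    rw [circ_compls]
    exact cocirc_nonempty_iff.2 hX'
  low_mem X hX := by
    obtain ⟨h1, h2⟩ := hZ.low_mem Xᶜ (Finset.mem_compls.1 hX)
    refine ⟨by rwa [clustered_compls, Finset.mem_compls], ?_⟩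
    rw [← compl_compl X, circ_compls, ← Finset.not_nonempty_iff_eq_empty, cocirc_nonempty_iff, h2]
    simp
  sparse X hX := by
    rw [clustered_compls, Finset.mem_compls] at hX
    refine le_trans ?_ (hZ.sparse _ hX)
    apply Finset.card_le_card_of_injOn fun p => (p.2, p.1)
    · rintro ⟨e, f⟩ h
      rw [Finset.mem_coe, Finset.mem_filter, Finset.mem_product, Finset.mem_sdiff,
        clustered_compls, region_dual hr, Finset.mem_compls, Finset.mem_compls,
        Finset.mem_compl] at h
      obtain ⟨⟨he, hf⟩, h⟩ := h
      rw [compl_swap he hf] at h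
      rw [Finset.mem_coe, Finset.mem_filter, Finset.mem_product, Finset.mem_sdiff]
      exact ⟨⟨Finset.mem_compl.2 hf, by simpa using he⟩, h⟩
    · rintro ⟨a, b⟩ _ ⟨c, d⟩ _ h
      simp only [Prod.mk.injEq] at h ⊢
      exact h.symm
  good X hX hXV := by
    rw [clustered_compls, Finset.mem_compls] at hX
    rw [region_dual hr, Finset.mem_compls] at hXV
    rw [← compl_compl X, good_compls]
    exact hZ.good _ hX hXV

end

/-- The dual of `card_mul_two_pow_le`. -/
theorem card_mul_two_pow_le_of_isCircuitType [Nonempty α] {r t q : ℕ} {Z : Cover α}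
    (hr : r + 3 ≤ Fintype.card α) (hr' : 4 * r ≤ 3 * Fintype.card α)
    (𝒦 : Finset (Finset (Finset α)))
    (h𝒦 : ∀ K ∈ 𝒦, IsNonbasisFamily r K ∧ IsValid r t K Z ∧
      ∃ Q, IsCircuitType K Z Q ∧ 8 * q ≤ Q.card) :
    𝒦.card * 2 ^ q ≤ Fintype.card α * (stableFamilies α (Fintype.card α - r)).card := by
  classical
  rw [← Finset.card_image_of_injective 𝒦 (f := fun K : Finset (Finset α) => Kᶜˢ)
    (fun K K' h => by simpa using congrArg (fun K : Finset (Finset α) => Kᶜˢ) h)]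
  apply card_mul_two_pow_le (r := Fintype.card α - r) (t := t) (Z := Z.dual) (by omega) (by omega)
  intro K' hK'
  obtain ⟨K, hK, rfl⟩ := Finset.mem_image.1 hK'
  obtain ⟨h1, h2, Q, h3, h4⟩ := h𝒦 K hK
  exact ⟨h1.compls, h2.dual (by omega), Qᶜˢ, h3.dual, by simpa using h4⟩

/-! ### Counting families of clustered non-bases -/

/-- The family of clustered non-bases described by a cover and representatives of the classes of
linked live sets. -/
def reconstruct (r t : ℕ) (Z : Cover α) (Q : Finset (Finset α)) : Set (Finset α) :=
  {Y | Y ∈ region r Z ∨ ∃ X ∈ Q, Relation.ReflTransGen (Step r t Z) X Y}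

/-- Every class has a representative of hyperplane type or of circuit type. If both kinds are few,
then all representatives together, and the cover, determine the clustered non-bases. -/
theorem exists_eq_reconstruct {r t : ℕ} {K : Finset (Finset α)} {Z : Cover α}
    (hK : IsNonbasisFamily r K) (hZ : IsValid r t K Z) (q : ℕ) :
    (∃ Q, IsHyperplaneType K Z Q ∧ 8 * q ≤ Q.card) ∨ (∃ Q, IsCircuitType K Z Q ∧ 8 * q ≤ Q.card) ∨
      ∃ Q : Finset (Finset α), Q.card ≤ 16 * q ∧
        (clustered K : Set (Finset α)) = reconstruct r t Z Q := by
  classical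
  obtain ⟨Q, -, hQ, hQ', hQ''⟩ := exists_transversal (K := K) (Z := Z) ∅ (by simp) (by simp)
  set QH := Q.filter fun X => ∃ f ∉ X, f ∉ cocirc K X with hQH
  set QC := Q.filter fun X => ∃ e ∈ X, e ∉ circ K X with hQC
  by_cases hH : 8 * q ≤ QH.card
  · refine Or.inl ⟨QH, ⟨fun X hX => ?_, fun X hX Y hY => ?_⟩, hH⟩
    · exact ⟨hQ X (Finset.mem_filter.1 hX).1, (Finset.mem_filter.1 hX).2⟩
    · exact hQ' X (Finset.mem_filter.1 hX).1 Y (Finset.mem_filter.1 hY).1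
  by_cases hC : 8 * q ≤ QC.card
  · refine Or.inr (Or.inl ⟨QC, ⟨fun X hX => ?_, fun X hX Y hY => ?_⟩, hC⟩)
    · exact ⟨hQ X (Finset.mem_filter.1 hX).1, (Finset.mem_filter.1 hX).2⟩
    · exact hQ' X (Finset.mem_filter.1 hX).1 Y (Finset.mem_filter.1 hY).1
  refine Or.inr (Or.inr ⟨Q, ?_, ?_⟩)
  · have : Q ⊆ QH ∪ QC := by
      intro X hX
      obtain ⟨hXK, e, he, f, hf, hs⟩ := mem_clustered.1 (hQ X hX).1
      rw [Finset.mem_union, hQH, hQC, Finset.mem_filter, Finset.mem_filter]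
      by_cases hfc : f ∈ cocirc K X
      · exact Or.inr ⟨hX, e, he, fun hec => hK.rect X hXK e hec f hfc hs⟩
      · exact Or.inl ⟨hX, f, hf, hfc⟩
    have := (Finset.card_le_card this).trans (Finset.card_union_le _ _)
    omega
  · ext Y
    constructor
    · intro hY
      by_cases hYV : Y ∈ region r Z
      · exact Or.inl hYV
      · obtain ⟨X, hX, hXY⟩ := hQ'' Y (hZ.live_of_notMem_region hK hY hYV)
        exact Or.inr ⟨X, hX, (hZ.reflTransGen_step_iff hK (hQ X hX)).2 hXY⟩
    · rintro (hY | ⟨X, hX, hXY⟩)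
      · exact hZ.region_subset hK hY
      · exact (((hZ.reflTransGen_step_iff hK (hQ X hX)).1 hXY).live (hQ X hX)).1

open Classical in
/-- The families of at most `κ` subsets of `β`. -/
noncomputable def smallFamilies (β : Type*) [Fintype β] (κ : ℝ) : Finset (Finset (Finset β)) :=
  Finset.univ.filter fun A => (A.card : ℝ) ≤ κ

/-- The covers all of whose parts have size at most `κ`. -/
noncomputable def smallCovers (β : Type*) [Fintype β] (κ : ℝ) : Finset (Cover β) :=
  smallFamilies β κ ×ˢ smallFamilies β κ ×ˢ smallFamilies β κ

theorem mem_smallFamilies {β : Type*} [Fintype β] {κ : ℝ} {A : Finset (Finset β)} :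
    A ∈ smallFamilies β κ ↔ (A.card : ℝ) ≤ κ := by simp [smallFamilies]

theorem mem_smallCovers {β : Type*} [Fintype β] {κ : ℝ} {Z : Cover β} : Z ∈ smallCovers β κ ↔
    (Z.1.card : ℝ) ≤ κ ∧ (Z.2.1.card : ℝ) ≤ κ ∧ (Z.2.2.card : ℝ) ≤ κ := by
  simp [smallCovers, mem_smallFamilies]

theorem card_smallCovers {β : Type*} [Fintype β] {κ : ℝ} :
    (smallCovers β κ).card = (smallFamilies β κ).card ^ 3 := by
  simp only [smallCovers, Finset.card_product]
  ring

/-- The clustered members of `K` can be reconstructed from a cover with parts of size at most `κ`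
and at most `16 * q` representatives. -/
def IsTame (r t : ℕ) (κ : ℝ) (q : ℕ) (K : Finset (Finset α)) : Prop :=
  ∃ Z ∈ smallCovers α κ, ∃ Q : Finset (Finset α), Q.card ≤ 16 * q ∧
    (clustered K : Set (Finset α)) = reconstruct r t Z Q

/-- The families `clustered K` of tame `K` are few. -/
theorem card_image_clustered_le {r t q : ℕ} {κ : ℝ} (𝒦 : Finset (Finset (Finset α)))
    (h𝒦 : ∀ K ∈ 𝒦, IsTame r t κ q K) : (𝒦.image clustered).card ≤
      (smallFamilies α κ).card ^ 3 * (smallFamilies α (16 * q)).card := by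
  classical
  rw [← card_smallCovers, ← Finset.card_product]
  have hex : ∀ U : Finset (Finset α), ∃ p : Cover α × Finset (Finset α), U ∈ 𝒦.image clustered →
      p ∈ smallCovers α κ ×ˢ smallFamilies α (16 * q) ∧
        (U : Set (Finset α)) = reconstruct r t p.1 p.2 := by
    intro U
    by_cases hU : U ∈ 𝒦.image clustered
    · obtain ⟨K, hK, rfl⟩ := Finset.mem_image.1 hU
      obtain ⟨Z, hZ, Q, hQ, h⟩ := h𝒦 K hK
      refine ⟨(Z, Q), fun _ => ⟨Finset.mem_product.2 ⟨hZ, mem_smallFamilies.2 ?_⟩, h⟩⟩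
      exact_mod_cast hQ
    · exact ⟨((∅, ∅, ∅), ∅), fun h => absurd h hU⟩
  choose p hp using hex
  apply Finset.card_le_card_of_injOn p
  · intro U hU
    exact (hp U hU).1
  · intro U hU U' hU' h
    have h1 := (hp U hU).2
    rw [h, ← (hp U' hU').2] at h1
    exact_mod_cast h1

/-- Families of non-bases that are not tame are few compared to stable families. -/
theorem card_not_isTame_mul_le {r q : ℕ} {κ : ℝ} (hn : 12 ≤ Fintype.card α)
    (hr1 : Fintype.card α ≤ 4 * r) (hr2 : 4 * r ≤ 3 * Fintype.card α)
    (hκ : (43 * Real.log (Fintype.card α) + 81) * (Fintype.card α).choose r /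
      (Fintype.card α : ℝ) ^ 2 + 2 ≤ κ) (𝒦 : Finset (Finset (Finset α)))
    (h𝒦 : ∀ K ∈ 𝒦, IsNonbasisFamily r K ∧ ¬ IsTame r (Fintype.card α / 10) κ q K) :
    𝒦.card * 2 ^ q ≤ (smallFamilies α κ).card ^ 3 * (Fintype.card α *
      ((stableFamilies α r).card + (stableFamilies α (Fintype.card α - r)).card)) := by
  classical
  have : Nonempty α := Fintype.card_pos_iff.1 (by omega)
  set t := Fintype.card α / 10
  let H : Cover α → Finset (Finset (Finset α)) := fun Z => 𝒦.filter fun K =>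
    IsValid r t K Z ∧ ∃ Q, IsHyperplaneType K Z Q ∧ 8 * q ≤ Q.card
  let C : Cover α → Finset (Finset (Finset α)) := fun Z => 𝒦.filter fun K =>
    IsValid r t K Z ∧ ∃ Q, IsCircuitType K Z Q ∧ 8 * q ≤ Q.card
  have hsub : 𝒦 ⊆ (smallCovers α κ).biUnion fun Z => H Z ∪ C Z := by
    intro K hK
    obtain ⟨hKn, hKt⟩ := h𝒦 K hK
    obtain ⟨Z, hZ, hZc⟩ := exists_isValid hKn (by omega) hr1 hr2 hκ
    refine Finset.mem_biUnion.2 ⟨Z, mem_smallCovers.2 hZc, ?_⟩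
    rw [Finset.mem_union, Finset.mem_filter, Finset.mem_filter]
    rcases exists_eq_reconstruct hKn hZ q with h | h | ⟨Q, h1, h2⟩
    · exact Or.inl ⟨hK, hZ, h⟩
    · exact Or.inr ⟨hK, hZ, h⟩
    · exact absurd ⟨Z, mem_smallCovers.2 hZc, Q, h1, h2⟩ hKt
  have hH : ∀ Z, (H Z).card * 2 ^ q ≤ Fintype.card α * (stableFamilies α r).card := fun Z =>
    card_mul_two_pow_le (t := t) (Z := Z) (by omega) hr1 _ fun K hK =>
      ⟨(h𝒦 K (Finset.mem_filter.1 hK).1).1, (Finset.mem_filter.1 hK).2⟩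
  have hC : ∀ Z, (C Z).card * 2 ^ q ≤
      Fintype.card α * (stableFamilies α (Fintype.card α - r)).card := fun Z =>
    card_mul_two_pow_le_of_isCircuitType (t := t) (Z := Z) (by omega) hr2 _ fun K hK =>
      ⟨(h𝒦 K (Finset.mem_filter.1 hK).1).1, (Finset.mem_filter.1 hK).2⟩
  calc 𝒦.card * 2 ^ q ≤ (∑ Z ∈ smallCovers α κ, (H Z ∪ C Z).card) * 2 ^ q :=
        Nat.mul_le_mul_right _ ((Finset.card_le_card hsub).trans Finset.card_biUnion_le)
    _ = ∑ Z ∈ smallCovers α κ, (H Z ∪ C Z).card * 2 ^ q := Finset.sum_mul _ _ _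
    _ ≤ ∑ _Z ∈ smallCovers α κ, Fintype.card α *
        ((stableFamilies α r).card + (stableFamilies α (Fintype.card α - r)).card) := by
        refine Finset.sum_le_sum fun Z _ => ?_
        have h1 := Nat.mul_le_mul_right (2 ^ q) (Finset.card_union_le (H Z) (C Z))
        have h2 := hH Z
        have h3 := hC Z
        rw [add_mul] at h1
        rw [mul_add]
        omega
    _ = _ := by rw [Finset.sum_const, smul_eq_mul, card_smallCovers]

end

section

/-! ### Non-bases of matroids -/

open Classical in
/-- The non-bases of a matroid of rank `r` whose ground set is the whole type, as finsets. -/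
noncomputable def nonbasisFamily {α : Type*} [Fintype α] (M : Matroid α) (r : ℕ) :
    Finset (Finset α) :=
  Finset.univ.filter fun X => X.card = r ∧ ¬ M.IsBase X

theorem mem_nonbasisFamily {α : Type*} [Fintype α] {M : Matroid α} {r : ℕ} {X : Finset α} :
    X ∈ nonbasisFamily M r ↔ X.card = r ∧ ¬ M.IsBase X := by simp [nonbasisFamily]

theorem notMem_nonbasisFamily {α : Type*} [Fintype α] {M : Matroid α} {r : ℕ} {X : Finset α}
    (hX : X.card = r) : X ∉ nonbasisFamily M r ↔ M.IsBase X := by simp [mem_nonbasisFamily, hX]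

section

variable {α : Type*} [DecidableEq α] [Fintype α] {M : Matroid α} {r : ℕ}

theorem isBase_dual_compl (hE : M.E = Set.univ) {X : Finset α} :
    M✶.IsBase (Xᶜ : Finset α) ↔ M.IsBase X := by
  rw [Matroid.dual_isBase_iff', hE, Finset.coe_compl]
  simp

theorem nonbasisFamily_dual (hE : M.E = Set.univ) (hr : r ≤ Fintype.card α) :
    nonbasisFamily M✶ (Fintype.card α - r) = (nonbasisFamily M r)ᶜˢ := by
  ext X
  rw [Finset.mem_compls, mem_nonbasisFamily, mem_nonbasisFamily, ← isBase_dual_compl hE,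
    compl_compl, Finset.card_compl]
  have := Finset.card_le_univ X
  refine and_congr (by omega) Iff.rfl

/-- A basis cannot contain the circuit of a non-basis that is adjacent to a basis. -/
theorem not_isBase_of_circ_subset (hM : ∀ B : Finset α, M.IsBase B → B.card = r) {X Y : Finset α}
    (hX : X ∈ nonbasisFamily M r) (hX' : (circ (nonbasisFamily M r) X).Nonempty)
    (h : circ (nonbasisFamily M r) X ⊆ Y) : ¬ M.IsBase Y := by
  intro hY
  obtain ⟨hXr, hXb⟩ := mem_nonbasisFamily.1 hX
  obtain ⟨e, he, f, hf, hs⟩ := circ_nonempty_iff.1 hX'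
  rw [notMem_nonbasisFamily ((card_swap he hf).trans hXr)] at hs
  obtain ⟨B', hB', h1, h2⟩ :=
    (hY.indep.subset (Finset.coe_subset.2 h)).exists_isBase_subset_union_isBase hs
  -- The circuit extends to a basis inside `X + f`, which omits an element outside the circuit.
  lift B' to Finset α using Set.toFinite B'
  have h3 : B' ⊆ insert f X := by
    intro a ha
    rcases h2 (Finset.mem_coe.2 ha) with h | h
    · exact Finset.mem_insert_of_mem (circ_subset (Finset.mem_coe.1 h))
    · exact swap_subset_insert (Finset.mem_coe.1 h)
  have h4 := hM B' hB'
  have h5 : (insert f X \ B').card = 1 := by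
    rw [Finset.card_sdiff_of_subset h3, Finset.card_insert_of_notMem hf]
    omega
  obtain ⟨a, ha⟩ := Finset.card_eq_one.1 h5
  have haB : a ∈ insert f X \ B' := by rw [ha]; exact Finset.mem_singleton_self a
  rw [Finset.mem_sdiff] at haB
  have hmem : ∀ x, x ∈ B' ↔ x ∈ insert f X ∧ x ≠ a := by
    intro x
    have : x ∈ insert f X \ B' ↔ x = a := by rw [ha, Finset.mem_singleton]
    rw [Finset.mem_sdiff] at this
    have := @h3 x
    tauto
  by_cases haf : a = f
  · have : B' = X := by
      ext x
      rw [hmem, haf, Finset.mem_insert]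
      have : x ∈ X → x ≠ f := fun h h' => hf (h' ▸ h)
      tauto
    exact hXb (this ▸ hB')
  · have haX : a ∈ X := (Finset.mem_insert.1 haB.1).resolve_left haf
    have : B' = swap X a f := by
      ext x
      rw [hmem, mem_swap, Finset.mem_insert]
      have : x = f → x ≠ a := fun h h' => haf (h' ▸ h)
      tauto
    have hac : a ∈ circ (nonbasisFamily M r) X := by
      refine mem_circ.2 ⟨haX, f, hf, ?_⟩
      rw [notMem_nonbasisFamily ((card_swap haX hf).trans hXr), ← this]
      exact hB'
    exact haB.2 (Finset.mem_coe.1 (h1 (Finset.mem_coe.2 hac)))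

theorem isNonbasisFamily_nonbasisFamily (hE : M.E = Set.univ) (hr : r ≤ Fintype.card α)
    (hM : ∀ B : Finset α, M.IsBase B → B.card = r) :
    IsNonbasisFamily r (nonbasisFamily M r) where
  card_eq X hX := (mem_nonbasisFamily.1 hX).1
  rect X hX e he f hf := by
    obtain ⟨hXr, hXb⟩ := mem_nonbasisFamily.1 hX
    obtain ⟨heX, f', hf', h1⟩ := mem_circ.1 he
    obtain ⟨hfX, e', he', h2⟩ := mem_cocirc.1 hf
    by_cases hff : f' = f
    · exact hff ▸ h1
    by_cases hee : e' = e
    · exact hee ▸ h2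
    rw [notMem_nonbasisFamily ((card_swap heX hf').trans hXr)] at h1
    rw [notMem_nonbasisFamily ((card_swap he' hfX).trans hXr)] at h2
    rw [notMem_nonbasisFamily ((card_swap heX hfX).trans hXr)]
    obtain ⟨y, hy, hb⟩ := h1.exchange h2 (e := f') (by
      rw [Set.mem_sdiff, Finset.mem_coe, Finset.mem_coe, mem_swap, mem_swap]
      tauto)
    rw [Set.mem_sdiff, Finset.mem_coe, Finset.mem_coe, mem_swap, mem_swap] at hy
    have hset : ∀ z, (insert z ((swap X e f' : Set α) \ {f'}) : Set α) =
        (swap X e z : Finset α) := by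
      intro z
      ext x
      simp only [Set.mem_insert_iff, Set.mem_sdiff, Finset.mem_coe, mem_swap, Set.mem_singleton_iff]
      have : x ∈ X → x ≠ f' := fun h h' => hf' (h' ▸ h)
      tauto
    rw [hset] at hb
    rcases hy with ⟨rfl | ⟨h3, h4⟩, h5⟩
    · exact hb
    · have : y = e := by tauto
      subst this
      have : swap X y y = X := by
        ext x; rw [mem_swap]
        by_cases hxy : x = y
        · simp [hxy, heX]
        · simp [hxy]
      rw [this] at hb
      exact absurd hb hXb
  mem_of_circ_subset X hX hX' Y hY h :=
    mem_nonbasisFamily.2 ⟨hY, not_isBase_of_circ_subset hM hX hX' h⟩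
  mem_of_disjoint_cocirc X hX hX' Y hY h := by
    have hM' : ∀ B : Finset α, M✶.IsBase B → B.card = Fintype.card α - r := by
      intro B hB
      rw [← compl_compl B, isBase_dual_compl hE] at hB
      have := hM _ hB
      rw [Finset.card_compl] at this
      have := Finset.card_le_univ B
      omega
    refine mem_nonbasisFamily.2 ⟨hY, ?_⟩
    rw [← isBase_dual_compl hE]
    have hd := nonbasisFamily_dual hE hr
    apply not_isBase_of_circ_subset hM' (X := Xᶜ)
    · rw [hd]; simpa using hX
    · rw [hd, circ_compls]; exact cocirc_nonempty_iff.2 hX'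
    · rw [hd, circ_compls]
      intro a ha
      rw [Finset.mem_compl]
      exact fun h' => Finset.disjoint_left.1 h h' ha

end

section

variable {n r : ℕ} {M : Matroid (Fin n)}

theorem card_of_isBase (hM : M ∈ Matroid.matroidsOnOfRank n r) (B : Finset (Fin n))
    (hB : M.IsBase B) : B.card = r := by
  have := hB.encard_eq_eRank
  rw [hM.2, Set.encard_coe_eq_coe_finsetCard] at this
  exact_mod_cast this

theorem isNonbasisFamily_of_mem (hM : M ∈ Matroid.matroidsOnOfRank n r) (hr : r ≤ n) :
    IsNonbasisFamily r (nonbasisFamily M r) :=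
  isNonbasisFamily_nonbasisFamily hM.1 (by simpa using hr) (card_of_isBase hM)

theorem nonbasisFamily_injOn :
    Set.InjOn (fun M => nonbasisFamily M r) (Matroid.matroidsOnOfRank n r) := by
  intro M hM M' hM' h
  have h' : nonbasisFamily M r = nonbasisFamily M' r := h
  have key : ∀ X : Finset (Fin n), M.IsBase X ↔ M'.IsBase X := by
    intro X
    by_cases hX : X.card = r
    · rw [← notMem_nonbasisFamily hX, h', notMem_nonbasisFamily hX]
    · exact iff_of_false (fun hb => hX (card_of_isBase hM X hb))
        (fun hb => hX (card_of_isBase hM' X hb))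
  refine Matroid.ext_isBase (by rw [hM.1, hM'.1]) fun B _ => ?_
  lift B to Finset (Fin n) using Set.toFinite B
  exact key B

theorem isBase_of_indep (hM : M ∈ Matroid.matroidsOnOfRank n r) {X : Finset (Fin n)}
    (hX : X.card = r) (h : M.Indep X) : M.IsBase X := by
  refine h.isBase_of_eRk_ge (Set.toFinite _) ?_
  rw [h.eRk_eq_encard, hM.2, Set.encard_coe_eq_coe_finsetCard, hX]

theorem coe_swap {X : Finset (Fin n)} {e f : Fin n} :
    ((swap X e f : Finset (Fin n)) : Set (Fin n)) = insert f ((X : Set (Fin n)) \ {e}) := by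
  simp [swap]

/-- A non-basis is a circuit-hyperplane if and only if all its neighbours are bases. -/
theorem mem_circuitHyperplanes_iff (hM : M ∈ Matroid.matroidsOnOfRank n r) (hr : 1 ≤ r)
    (hrn : r < n) {X : Finset (Fin n)} (hX : X ∈ nonbasisFamily M r) :
    (X : Set (Fin n)) ∈ M.circuitHyperplanes ↔ X ∉ clustered (nonbasisFamily M r) := by
  obtain ⟨hXr, hXb⟩ := mem_nonbasisFamily.1 hX
  have hE : ∀ x, x ∈ M.E := fun x => by rw [hM.1]; trivial
  have hXE : (X : Set (Fin n)) ⊆ M.E := fun x _ => hE x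
  constructor
  · rintro ⟨hC, hF, -⟩ hcl
    obtain ⟨-, e, he, f, hf, hs⟩ := mem_clustered.1 hcl
    refine (mem_nonbasisFamily.1 hs).2 (isBase_of_indep hM ((card_swap he hf).trans hXr) ?_)
    have hI : M.Indep ((X : Set (Fin n)) \ {e}) := hC.sdiff_singleton_indep (by simpa using he)
    have hfc : f ∉ M.closure ((X : Set (Fin n)) \ {e}) := by
      rw [hC.closure_sdiff_singleton_eq, hF.closure]
      simpa using hf
    rw [coe_swap]
    exact ((hI.notMem_closure_iff (hE f)).1 hfc).1
  · intro hcl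
    have hall : ∀ e ∈ X, ∀ f ∉ X, M.IsBase (swap X e f : Finset (Fin n)) := by
      intro e he f hf
      rw [← notMem_nonbasisFamily ((card_swap he hf).trans hXr)]
      intro h
      exact hcl (mem_clustered.2 ⟨hX, e, he, f, hf, h⟩)
    obtain ⟨f₀, hf₀⟩ : ∃ f, f ∉ X := by
      by_contra! h
      have : X = Finset.univ := Finset.eq_univ_iff_forall.2 h
      rw [this, Finset.card_univ, Fintype.card_fin] at hXr
      omega
    obtain ⟨e₀, he₀⟩ : X.Nonempty := Finset.card_pos.1 (by omega)
    have hI : ∀ e ∈ X, M.Indep ((X : Set (Fin n)) \ {e}) := by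
      intro e he
      have := (hall e he f₀ hf₀).indep
      rw [coe_swap] at this
      exact this.subset (Set.subset_insert _ _)
    have hC : M.IsCircuit (X : Set (Fin n)) := by
      rw [Matroid.isCircuit_iff_dep_forall_sdiff_singleton_indep]
      refine ⟨⟨fun h => hXb (isBase_of_indep hM hXr h), hXE⟩, fun e he => hI e (by simpa using he)⟩
    refine ⟨hC, ?_, ?_⟩
    · rw [Matroid.isFlat_iff_closure_eq]
      refine subset_antisymm ?_ (M.subset_closure _ hXE)
      intro f hf
      by_contra hfX
      rw [← hC.closure_sdiff_singleton_eq e₀] at hf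
      have := (hall e₀ he₀ f (by simpa using hfX)).indep
      rw [coe_swap] at this
      exact ((hI e₀ he₀).notMem_closure_iff (hE f)).2 ⟨this, fun h => hfX h.1⟩ hf
    · rw [hC.eRk_add_one_eq, hM.2, Set.encard_coe_eq_coe_finsetCard, hXr]

/-- The non-bases that are not circuit-hyperplanes are the clustered non-bases. -/
theorem bigNonbases_eq (hM : M ∈ Matroid.matroidsOnOfRank n r) (hr : 1 ≤ r) (hrn : r < n) :
    M.bigNonbases =
      (fun X : Finset (Fin n) => (X : Set (Fin n))) '' (clustered (nonbasisFamily M r)) := by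
  ext X
  lift X to Finset (Fin n) using Set.toFinite X
  have h1 : (X : Set (Fin n)) ∈ M.nonbases ↔ X ∈ nonbasisFamily M r := by
    rw [mem_nonbasisFamily, Matroid.nonbases, Set.mem_ofPred_eq, hM.1, hM.2,
      Set.encard_coe_eq_coe_finsetCard, Nat.cast_inj]
    simp
  have h2 : (X : Set (Fin n)) ∈ (fun X : Finset (Fin n) => (X : Set (Fin n))) ''
      (clustered (nonbasisFamily M r)) ↔ X ∈ clustered (nonbasisFamily M r) := by
    constructor
    · rintro ⟨Y, hY, h⟩
      have : Y = X := Finset.coe_injective h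
      exact this ▸ hY
    · exact fun h => ⟨X, h, rfl⟩
  rw [h2, Matroid.bigNonbases, Set.mem_sdiff, h1]
  constructor
  · rintro ⟨h3, h4⟩
    rw [mem_circuitHyperplanes_iff hM hr hrn h3, not_not] at h4
    exact h4
  · intro h
    have h3 := (mem_clustered.1 h).1
    exact ⟨h3, by rw [mem_circuitHyperplanes_iff hM hr hrn h3, not_not]; exact h⟩

/-- Every stable set of the Johnson graph is the family of non-bases of a matroid. Such matroids
are known as sparse paving matroids. -/
theorem exists_nonbasisFamily_eq (hr : 1 ≤ r) (hrn : r < n) {T : Finset (Finset (Fin n))}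
    (hT : T ∈ stableFamilies (Fin n) r) :
    ∃ M ∈ Matroid.matroidsOnOfRank n r, nonbasisFamily M r = T := by
  obtain ⟨hTr, hTs⟩ := mem_stableFamilies.1 hT
  let P : Set (Fin n) → Prop := fun B => ∃ F : Finset (Fin n), (F : Set (Fin n)) = B ∧
    F.card = r ∧ F ∉ T
  have hP : ∀ F : Finset (Fin n), P F ↔ F.card = r ∧ F ∉ T := by
    intro F
    constructor
    · rintro ⟨G, hG, h⟩
      have : G = F := by exact_mod_cast hG
      exact this ▸ h
    · exact fun h => ⟨F, rfl, h⟩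
  have hex : ∃ B, P B := by
    obtain ⟨X, hX⟩ : ∃ X : Finset (Fin n), X.card = r := by
      obtain ⟨X, -, hX⟩ := Finset.exists_subset_card_eq (s := (Finset.univ : Finset (Fin n)))
        (n := r) (by simpa using hrn.le)
      exact ⟨X, hX⟩
    by_cases hXT : X ∈ T
    · obtain ⟨e, he⟩ : X.Nonempty := Finset.card_pos.1 (by omega)
      obtain ⟨f, hf⟩ : ∃ f, f ∉ X := by
        by_contra! h
        have : X = Finset.univ := Finset.eq_univ_iff_forall.2 h
        rw [this, Finset.card_univ, Fintype.card_fin] at hX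
        omega
      refine ⟨_, (hP (swap X e f)).2 ⟨(card_swap he hf).trans hX, fun h => ?_⟩⟩
      exact hTs X hXT _ h ⟨e, he, f, hf, rfl⟩
    · exact ⟨X, (hP X).2 ⟨hX, hXT⟩⟩
  have hexch : Matroid.ExchangeProperty P := by
    rintro _ _ ⟨X, rfl, hX, hXT⟩ ⟨Y, rfl, hY, hYT⟩ e he
    rw [Set.mem_sdiff, Finset.mem_coe, Finset.mem_coe] at he
    have hsw : ∀ f ∈ Y \ X, swap X e f ∉ T →
        ∃ b ∈ (Y : Set (Fin n)) \ X, P (insert b ((X : Set (Fin n)) \ {e})) := by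
      intro f hf h
      rw [Finset.mem_sdiff] at hf
      refine ⟨f, by simpa using hf, ?_⟩
      rw [← coe_swap, hP]
      exact ⟨(card_swap he.1 hf.2).trans hX, h⟩
    by_contra hno
    have hall : ∀ f ∈ Y \ X, swap X e f ∈ T := fun f hf => by
      by_contra h
      exact hno (hsw f hf h)
    have hne : (Y \ X).Nonempty := by
      rw [Finset.nonempty_iff_ne_empty]
      intro h
      have : Y = X :=
        Finset.eq_of_subset_of_card_le (Finset.sdiff_eq_empty_iff_subset.1 h) (by omega)
      exact he.2 (this ▸ he.1)
    obtain ⟨f, hf⟩ := hne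
    have hfm := Finset.mem_sdiff.1 hf
    -- If `Y - X` had another element, two adjacent sets would be members of `T`.
    by_cases h1 : ∃ f' ∈ Y \ X, f' ≠ f
    · obtain ⟨f', hf', hff⟩ := h1
      have hfm' := Finset.mem_sdiff.1 hf'
      refine hTs _ (hall f hf) _ (hall f' hf') ⟨f, mem_swap_self, f', ?_, ?_⟩
      · rw [mem_swap]; tauto
      · ext x
        simp only [mem_swap]
        have : x = f → x ∉ X := fun h => h ▸ hfm.2
        tauto
    · push Not at h1
      have hXY : swap X e f = Y := by
        symm
        apply Finset.eq_of_subset_of_card_le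
        · intro y hy
          rw [mem_swap]
          by_cases hyX : y ∈ X
          · exact Or.inr ⟨fun h => he.2 (h ▸ hy), hyX⟩
          · exact Or.inl (h1 y (Finset.mem_sdiff.2 ⟨hy, hyX⟩))
        · rw [card_swap he.1 hfm.2]; omega
      exact hYT (hXY ▸ hall f hf)
  let M := Matroid.ofIsBaseOfFinite (E := Set.univ) Set.finite_univ P hex hexch
    (fun _ _ => Set.subset_univ _)
  have hMb : ∀ F : Finset (Fin n), M.IsBase F ↔ F.card = r ∧ F ∉ T := hP
  refine ⟨M, ⟨rfl, ?_⟩, ?_⟩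
  · obtain ⟨B, hB⟩ := M.exists_isBase
    rw [← hB.encard_eq_eRank]
    obtain ⟨F, rfl, hF, -⟩ : P B := hB
    rw [Set.encard_coe_eq_coe_finsetCard, hF]
  · ext X
    rw [mem_nonbasisFamily, hMb]
    constructor
    · rintro ⟨h1, h2⟩
      by_contra h
      exact h2 ⟨h1, h⟩
    · exact fun h => ⟨hTr X h, fun h' => h'.2 h⟩

theorem finite_matroidsOn : (Matroid.matroidsOn n).Finite := by
  have : Set.InjOn (fun M : Matroid (Fin n) => {B | M.IsBase B}) (Matroid.matroidsOn n) := by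
    intro M hM M' hM' h
    refine Matroid.ext_isBase (by rw [hM, hM']) fun B _ => ?_
    have : B ∈ {B | M.IsBase B} ↔ B ∈ {B | M'.IsBase B} := by
      rw [show {B | M.IsBase B} = {B | M'.IsBase B} from h]
    exact this
  exact Set.Finite.of_finite_image (Set.toFinite _) this

theorem card_stableFamilies_le (hr : 1 ≤ r) (hrn : r < n) :
    (stableFamilies (Fin n) r).card ≤ (Matroid.matroidsOn n).ncard := by
  have hex : ∀ T : Finset (Finset (Fin n)), ∃ M : Matroid (Fin n), T ∈ stableFamilies (Fin n) r →
      M ∈ Matroid.matroidsOnOfRank n r ∧ nonbasisFamily M r = T := by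
    intro T
    by_cases hT : T ∈ stableFamilies (Fin n) r
    · obtain ⟨M, hM, h⟩ := exists_nonbasisFamily_eq hr hrn hT
      exact ⟨M, fun _ => ⟨hM, h⟩⟩
    · exact ⟨Matroid.emptyOn _, fun h => absurd h hT⟩
  choose m hm using hex
  rw [← Set.ncard_coe_finset]
  refine Set.ncard_le_ncard_of_injOn m (fun T hT => (hm T hT).1.1) ?_ finite_matroidsOn
  intro T hT T' hT' h
  rw [← (hm T hT).2, ← (hm T' hT').2, h]

end

end

section

/-! ### Estimates -/

theorem logb_natCast_le {c : ℕ} {x : ℝ} (hx : 0 ≤ x) (h : (c : ℝ) ≤ 2 ^ x) :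
    Real.logb 2 c ≤ x := by
  rcases Nat.eq_zero_or_pos c with rfl | hc
  · simpa using hx
  · rw [Real.logb_le_iff_le_rpow (by norm_num) (by exact_mod_cast hc)]
    exact h

/-- In the lower third of the binomial coefficients, consecutive ones differ by a factor of at least
`2`. -/
theorem two_pow_mul_choose_le {n r : ℕ} (j : ℕ) (h : 3 * (r + j) ≤ n) :
    2 ^ j * n.choose r ≤ n.choose (r + j) := by
  induction j with
  | zero => simp
  | succ j ih =>
    have h1 := ih (by omega)
    have h2 := Nat.choose_succ_right_eq n (r + j)
    have h3 : 2 * n.choose (r + j) ≤ n.choose (r + j + 1) := by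
      have h4 : 2 * (r + j + 1) ≤ n - (r + j) := by omega
      have h5 := Nat.mul_le_mul_left (n.choose (r + j)) h4
      rw [← h2] at h5
      have : 2 * n.choose (r + j) * (r + j + 1) ≤ n.choose (r + j + 1) * (r + j + 1) := by
        linarith
      exact Nat.le_of_mul_le_mul_right this (by omega)
    rw [pow_succ, ← add_assoc]
    linarith

theorem sq_mul_choose_le_of_lt {n r : ℕ} (hn : 32 * n ^ 24 ≤ 2 ^ n) (hr : 4 * r < n) :
    n ^ 2 * n.choose r ≤ n.choose (n / 2) := by
  have h1 := two_pow_mul_choose_le (n := n) (r := r) (n / 3 - r) (by omega)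
  refine le_trans (Nat.mul_le_mul_right _ ?_) (h1.trans (Nat.choose_le_middle _ _))
  have h2 : 2 ^ n ≤ 2 ^ (5 + 12 * (n / 3 - r)) := Nat.pow_le_pow_right (by norm_num) (by omega)
  have h3 : (n ^ 2) ^ 12 ≤ (2 ^ (n / 3 - r)) ^ 12 := by
    rw [pow_add] at h2
    rw [← pow_mul, ← pow_mul, mul_comm (n / 3 - r) 12]
    norm_num at h2 ⊢
    omega
  exact (Nat.pow_le_pow_iff_left (by norm_num)).1 h3

theorem sq_mul_choose_le {n r : ℕ} (hn : 32 * n ^ 24 ≤ 2 ^ n) (hrn : r ≤ n)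
    (hr : ¬ (n ≤ 4 * r ∧ 4 * r ≤ 3 * n)) : n ^ 2 * n.choose r ≤ n.choose (n / 2) := by
  by_cases h : n ≤ 4 * r
  · rw [← Nat.choose_symm hrn]
    exact sq_mul_choose_le_of_lt hn (by omega)
  · exact sq_mul_choose_le_of_lt hn (by omega)

theorem two_pow_le_mul_choose (n : ℕ) : 2 ^ n ≤ (n + 1) * n.choose (n / 2) := by
  rw [← Nat.sum_range_choose, ← smul_eq_mul]
  calc ∑ m ∈ Finset.range (n + 1), n.choose m
      ≤ (Finset.range (n + 1)).card • n.choose (n / 2) :=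
        Finset.sum_le_card_nsmul _ _ _ fun m _ => Nat.choose_le_middle m n
    _ = _ := by rw [Finset.card_range]

theorem eventually_mul_pow_le (c k : ℕ) : ∀ᶠ n : ℕ in atTop, c * n ^ k ≤ 2 ^ n := by
  have h := tendsto_pow_const_div_const_pow_of_one_lt k (r := (2 : ℝ)) (by norm_num)
  have h1 : (0 : ℝ) < 1 / (c + 1) := by positivity
  filter_upwards [h.eventually (gt_mem_nhds h1)] with n hn
  rw [div_lt_div_iff₀ (by positivity) (by positivity)] at hn
  have : ((c * n ^ k : ℕ) : ℝ) ≤ (2 ^ n : ℕ) := by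
    push_cast
    nlinarith [pow_nonneg (Nat.cast_nonneg n : (0 : ℝ) ≤ n) k]
  exact_mod_cast this

/-- The conditions under which `n` is large enough for all estimates. -/
structure IsLarge (n : ℕ) : Prop where
  le : 12 ≤ n
  far : 32 * n ^ 24 ≤ 2 ^ n
  middle : (n : ℝ) ≤ n.choose (n / 2) / (n : ℝ) ^ 2

theorem eventually_isLarge : ∀ᶠ n in atTop, IsLarge n := by
  filter_upwards [eventually_ge_atTop 12, eventually_mul_pow_le 32 24,
    eventually_mul_pow_le 2 4] with n h1 h2 h3
  refine ⟨h1, h2, ?_⟩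
  have hn : (0 : ℝ) < n := by exact_mod_cast (by omega : 0 < n)
  rw [le_div_iff₀ (by positivity)]
  have h4 : (2 : ℕ) * n ^ 4 ≤ 2 * n * n.choose (n / 2) :=
    (h3.trans (two_pow_le_mul_choose n)).trans (Nat.mul_le_mul_right _ (by omega))
  have h5 : n * n ^ 2 ≤ n.choose (n / 2) := by
    have : 2 * n * (n * n ^ 2) ≤ 2 * n * n.choose (n / 2) := by
      calc 2 * n * (n * n ^ 2) = 2 * n ^ 4 := by ring
        _ ≤ _ := h4
    exact Nat.le_of_mul_le_mul_left this (by omega)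
  exact_mod_cast h5

/-- The quantity `log n / n ^ 2 * (n choose n / 2)`, which is the order of magnitude of the size of
covers. -/
noncomputable def scale (n : ℕ) : ℝ := Real.logb 2 n * n.choose (n / 2) / (n : ℝ) ^ 2

section

theorem IsLarge.one_le_logb {n : ℕ} (hn : IsLarge n) : 1 ≤ Real.logb 2 n := by
  have h := hn.le
  rw [Real.le_logb_iff_rpow_le (by norm_num) (by exact_mod_cast (by omega : 0 < n)), Real.rpow_one]
  exact_mod_cast (by omega : 2 ≤ n)

theorem IsLarge.choose_div_le_scale {n : ℕ} (hn : IsLarge n) :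
    n.choose (n / 2) / (n : ℝ) ^ 2 ≤ scale n := by
  rw [scale, mul_div_assoc]
  exact le_mul_of_one_le_left (by positivity) hn.one_le_logb

theorem IsLarge.le_scale {n : ℕ} (hn : IsLarge n) : (n : ℝ) ≤ scale n :=
  hn.middle.trans hn.choose_div_le_scale

theorem IsLarge.scale_le {n : ℕ} (hn : IsLarge n) : scale n ≤ scale n * Real.logb 2 n :=
  le_mul_of_one_le_right (le_trans (by positivity) hn.le_scale) hn.one_le_logb

/-- Weighting each family `A` by `n ^ (-3 |A|)` bounds the number of small families. -/
theorem IsLarge.card_smallFamilies_le {n : ℕ} (hn : IsLarge n) (κ : ℝ) :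
    ((smallFamilies (Fin n) κ).card : ℝ) ≤ 2 ^ (3 * κ * Real.logb 2 n + 4 * scale n) := by
  have h12 := hn.le
  have hn0 : (0 : ℝ) < n := by exact_mod_cast (by omega : 0 < n)
  have hn1 : (1 : ℝ) ≤ n := by exact_mod_cast (by omega : 1 ≤ n)
  set x : ℝ := ((n : ℝ) ^ 3)⁻¹ with hx
  have hx0 : 0 < x := by positivity
  have hx1 : x ≤ 1 := inv_le_one_of_one_le₀ (one_le_pow₀ hn1)
  have hxκ : x ^ κ = 2 ^ (-(3 * κ * Real.logb 2 n)) := by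
    have h2 : (2 : ℝ) ^ Real.logb 2 n = n := Real.rpow_logb (by norm_num) (by norm_num) hn0
    rw [show -(3 * κ * Real.logb 2 n) = Real.logb 2 n * (-(3 * κ)) by ring,
      Real.rpow_mul (by norm_num), h2, hx, Real.inv_rpow (by positivity), ← Real.rpow_natCast,
      ← Real.rpow_mul hn0.le, Real.rpow_neg hn0.le]
    norm_num
  have hsum : ((smallFamilies (Fin n) κ).card : ℝ) * x ^ κ ≤ (x + 1) ^ (2 ^ n) := by
    have h1 := Finset.sum_pow_mul_eq_add_pow x 1 (Finset.univ : Finset (Finset (Fin n)))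
    rw [Finset.card_univ, Fintype.card_finset, Fintype.card_fin] at h1
    rw [← h1, ← nsmul_eq_mul]
    refine (Finset.card_nsmul_le_sum _ (fun A => x ^ A.card) _ fun A hA => ?_).trans ?_
    · rw [← Real.rpow_natCast]
      exact Real.rpow_le_rpow_of_exponent_ge hx0 hx1 (mem_smallFamilies.1 hA)
    · simp only [one_pow, mul_one]
      exact Finset.sum_le_sum_of_subset_of_nonneg (by simp) fun _ _ _ => by positivity
  have hexp : (x + 1) ^ (2 ^ n) ≤ (2 : ℝ) ^ (4 * scale n) := by
    have h1 : (x + 1) ^ (2 ^ n) ≤ Real.exp (x * 2 ^ n) := by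
      calc (x + 1) ^ (2 ^ n) ≤ (Real.exp x) ^ (2 ^ n) := by
            gcongr
            exact Real.add_one_le_exp x
        _ = Real.exp (x * 2 ^ n) := by
            rw [← Real.exp_nat_mul]
            push_cast
            ring_nf
    have h2 : x * 2 ^ n ≤ 2 * scale n := by
      have h3 : (2 : ℝ) ^ n ≤ (n + 1) * n.choose (n / 2) := by
        exact_mod_cast two_pow_le_mul_choose n
      calc x * 2 ^ n ≤ x * ((n + 1) * n.choose (n / 2)) := by gcongr
        _ ≤ x * ((2 * n) * n.choose (n / 2)) := by
            gcongr
            linarith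
        _ = 2 * (n.choose (n / 2) / (n : ℝ) ^ 2) := by rw [hx]; field_simp
        _ ≤ 2 * scale n := by
            have := hn.choose_div_le_scale
            linarith
    have h0 : 0 ≤ scale n := le_trans hn0.le hn.le_scale
    calc (x + 1) ^ (2 ^ n) ≤ Real.exp (x * 2 ^ n) := h1
      _ ≤ Real.exp (Real.log 2 * (4 * scale n)) := by
          apply Real.exp_le_exp.2
          have := Real.log_two_gt_d9
          nlinarith
      _ = (2 : ℝ) ^ (4 * scale n) := by rw [Real.rpow_def_of_pos (by norm_num)]
  have h3 := hsum.trans hexp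
  rw [hxκ, Real.rpow_neg (by norm_num), ← div_eq_mul_inv, div_le_iff₀ (by positivity),
    ← Real.rpow_add (by norm_num)] at h3
  rwa [add_comm]

end

/-- The bound on the sizes of the parts of a cover. -/
noncomputable def coverBound (n : ℕ) : ℝ := 126 * scale n

/-- The bound, up to the factor `16` in `IsTame`, on the number of classes of linked live sets. The
constant is chosen such that `2 ^ classBound n` exceeds the number of small covers by a factor of at
least `2 ^ n`. -/
noncomputable def classBound (n : ℕ) : ℕ := ⌈1148 * (scale n * Real.logb 2 n)⌉₊

theorem IsLarge.le_coverBound {n r : ℕ} (hn : IsLarge n) :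
    (43 * Real.log n + 81) * n.choose r / (n : ℝ) ^ 2 + 2 ≤ coverBound n := by
  have h12 := hn.le
  have hn0 : (0 : ℝ) < n := by exact_mod_cast (by omega : 0 < n)
  have h1 := hn.one_le_logb
  have hlog0 : 0 ≤ Real.log n := Real.log_nonneg (by exact_mod_cast (by omega : 1 ≤ n))
  have h2 : Real.log n ≤ Real.logb 2 n := by
    rw [Real.logb, le_div_iff₀ (Real.log_pos (by norm_num))]
    have := Real.log_two_lt_d9
    nlinarith
  have h3 : (n.choose r : ℝ) ≤ n.choose (n / 2) := by exact_mod_cast Nat.choose_le_middle r n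
  have h4 : (2 : ℝ) ≤ 2 * scale n := by
    have := hn.le_scale
    have : (12 : ℝ) ≤ n := by exact_mod_cast h12
    linarith
  have h5 : (43 * Real.log n + 81) * n.choose r / (n : ℝ) ^ 2 ≤ 124 * scale n := by
    calc (43 * Real.log n + 81) * n.choose r / (n : ℝ) ^ 2
        ≤ (124 * Real.logb 2 n) * n.choose (n / 2) / (n : ℝ) ^ 2 := by
          gcongr
          linarith
      _ = 124 * scale n := by rw [scale]; ring
  rw [coverBound]
  linarith

theorem IsLarge.card_smallFamilies_pow_le {n : ℕ} (hn : IsLarge n) :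
    ((smallFamilies (Fin n) (coverBound n)).card : ℝ) ^ 3 ≤
      2 ^ (1146 * (scale n * Real.logb 2 n)) := by
  calc ((smallFamilies (Fin n) (coverBound n)).card : ℝ) ^ 3
      ≤ (2 ^ (3 * coverBound n * Real.logb 2 n + 4 * scale n)) ^ 3 := by
        gcongr
        exact hn.card_smallFamilies_le _
    _ = 2 ^ ((3 * coverBound n * Real.logb 2 n + 4 * scale n) * 3) := by
        rw [Real.rpow_mul (by norm_num)]
        norm_cast
    _ ≤ 2 ^ (1146 * (scale n * Real.logb 2 n)) := by
        apply Real.rpow_le_rpow_of_exponent_le (by norm_num)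
        have := hn.scale_le
        rw [coverBound]
        linarith

theorem IsLarge.classBound_le {n : ℕ} (hn : IsLarge n) :
    (classBound n : ℝ) ≤ 1149 * (scale n * Real.logb 2 n) := by
  have h1 := hn.scale_le
  have h2 := hn.le_scale
  have h3 : (12 : ℝ) ≤ n := by exact_mod_cast hn.le
  have := (Nat.ceil_lt_add_one (a := 1148 * (scale n * Real.logb 2 n)) (by linarith)).le
  rw [classBound]
  linarith

/-! ### Almost all matroids are tame -/

/-- The matroids on `n` elements whose non-bases form a tame family, for large `n`. Ranks far from
`n / 2` need no condition, since there are few sets of such sizes. -/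
def tameMatroids (n : ℕ) : Set (Matroid (Fin n)) :=
  {M | M ∈ Matroid.matroidsOn n ∧ IsLarge n ∧ ∀ r : ℕ, M.eRank = r → n ≤ 4 * r → 4 * r ≤ 3 * n →
    IsTame r (n / 10) (coverBound n) (classBound n) (nonbasisFamily M r)}

section

variable {n r : ℕ}

theorem IsLarge.ncard_not_tame_le (hn : IsLarge n) (r : ℕ) :
    ({M | M ∈ Matroid.matroidsOnOfRank n r ∧ n ≤ 4 * r ∧ 4 * r ≤ 3 * n ∧
      ¬ IsTame r (n / 10) (coverBound n) (classBound n) (nonbasisFamily M r)}.ncard : ℝ) ≤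
      2 * n * 2⁻¹ ^ n * (Matroid.matroidsOn n).ncard := by
  classical
  set S := {M | M ∈ Matroid.matroidsOnOfRank n r ∧ n ≤ 4 * r ∧ 4 * r ≤ 3 * n ∧
    ¬ IsTame r (n / 10) (coverBound n) (classBound n) (nonbasisFamily M r)} with hS
  set m := (Matroid.matroidsOn n).ncard with hm
  by_cases hr : n ≤ 4 * r ∧ 4 * r ≤ 3 * n
  swap
  · have : S = ∅ := by
      ext M
      simp only [hS, Set.mem_ofPred_eq, Set.mem_empty_iff_false, iff_false]
      tauto
    rw [this, Set.ncard_empty, Nat.cast_zero]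
    positivity
  obtain ⟨hr1, hr2⟩ := hr
  have h12 := hn.le
  have hSsub : S ⊆ Matroid.matroidsOn n := fun M hM => hM.1.1
  have hSfin : S.Finite := finite_matroidsOn.subset hSsub
  set 𝒦 := hSfin.toFinset.image fun M => nonbasisFamily M r with h𝒦
  have hcard : 𝒦.card = S.ncard := by
    rw [h𝒦, Finset.card_image_of_injOn, Set.ncard_eq_toFinset_card S hSfin]
    exact nonbasisFamily_injOn.mono fun M hM => by
      rw [Set.Finite.coe_toFinset] at hM
      exact hM.1
  have hmain := card_not_isTame_mul_le (α := Fin n) (r := r) (q := classBound n)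
    (κ := coverBound n) (by simpa using h12) (by simpa using hr1) (by simpa using hr2)
    (by simpa using hn.le_coverBound) 𝒦 (by
      intro K hK
      obtain ⟨M, hM, rfl⟩ := Finset.mem_image.1 hK
      rw [Set.Finite.mem_toFinset] at hM
      refine ⟨isNonbasisFamily_of_mem hM.1 (by omega), ?_⟩
      rw [Fintype.card_fin]
      exact hM.2.2.2)
  rw [hcard, Fintype.card_fin] at hmain
  have hs1 := card_stableFamilies_le (n := n) (r := r) (by omega) (by omega)
  have hs2 := card_stableFamilies_le (n := n) (r := n - r) (by omega) (by omega)
  have h1 : S.ncard * 2 ^ classBound n ≤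
      (smallFamilies (Fin n) (coverBound n)).card ^ 3 * (n * (m + m)) :=
    hmain.trans (Nat.mul_le_mul_left _ (Nat.mul_le_mul_left _ (Nat.add_le_add hs1 hs2)))
  have h2 : (S.ncard : ℝ) * 2 ^ classBound n ≤
      ((smallFamilies (Fin n) (coverBound n)).card : ℝ) ^ 3 * (n * (m + m)) := by
    exact_mod_cast h1
  have h3 : (2 : ℝ) ^ (1148 * (scale n * Real.logb 2 n)) ≤ 2 ^ classBound n := by
    rw [← Real.rpow_natCast]
    exact Real.rpow_le_rpow_of_exponent_le (by norm_num) (Nat.le_ceil _)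
  have h4 : (2 : ℝ) ^ (1146 * (scale n * Real.logb 2 n)) * 2 ^ n ≤
      2 ^ (1148 * (scale n * Real.logb 2 n)) := by
    rw [← Real.rpow_natCast, ← Real.rpow_add (by norm_num)]
    apply Real.rpow_le_rpow_of_exponent_le (by norm_num)
    have := hn.scale_le
    have := hn.le_scale
    have : (0 : ℝ) ≤ n := Nat.cast_nonneg n
    linarith
  have h5 : (S.ncard : ℝ) * (2 ^ (1146 * (scale n * Real.logb 2 n)) * 2 ^ n) ≤
      2 ^ (1146 * (scale n * Real.logb 2 n)) * (n * (m + m)) := by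
    calc (S.ncard : ℝ) * (2 ^ (1146 * (scale n * Real.logb 2 n)) * 2 ^ n)
        ≤ S.ncard * 2 ^ classBound n := by
          have := h4.trans h3
          gcongr
      _ ≤ _ := h2
      _ ≤ _ := by
          have := hn.card_smallFamilies_pow_le
          gcongr
  have hpos : (0 : ℝ) < 2 ^ (1146 * (scale n * Real.logb 2 n)) := by positivity
  have h6 : (S.ncard : ℝ) * 2 ^ n ≤ n * (m + m) := by
    refine le_of_mul_le_mul_left ?_ hpos
    linarith
  have h7 : (S.ncard : ℝ) ≤ n * (m + m) / 2 ^ n := by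
    rw [le_div_iff₀ (by positivity)]
    exact h6
  calc (S.ncard : ℝ) ≤ n * (m + m) / 2 ^ n := h7
    _ = 2 * n * 2⁻¹ ^ n * m := by rw [inv_pow]; ring

theorem exists_mem_matroidsOnOfRank {M : Matroid (Fin n)} (hM : M ∈ Matroid.matroidsOn n) :
    ∃ r ≤ n, M ∈ Matroid.matroidsOnOfRank n r := by
  obtain ⟨B, hB⟩ := M.exists_isBase
  lift B to Finset (Fin n) using Set.toFinite B
  have := hB.encard_eq_eRank
  rw [Set.encard_coe_eq_coe_finsetCard] at this
  exact ⟨B.card, by simpa using Finset.card_le_univ B, hM, this.symm⟩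

theorem IsLarge.ncard_diff_tameMatroids_le (hn : IsLarge n) :
    ((Matroid.matroidsOn n \ tameMatroids n).ncard : ℝ) ≤
      (n + 1) * (2 * n * 2⁻¹ ^ n * (Matroid.matroidsOn n).ncard) := by
  set S : ℕ → Set (Matroid (Fin n)) := fun r => {M | M ∈ Matroid.matroidsOnOfRank n r ∧
    n ≤ 4 * r ∧ 4 * r ≤ 3 * n ∧
      ¬ IsTame r (n / 10) (coverBound n) (classBound n) (nonbasisFamily M r)} with hS
  have hsub : Matroid.matroidsOn n \ tameMatroids n ⊆ ⋃ r ∈ Finset.range (n + 1), S r := by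
    rintro M ⟨hM, hMt⟩
    obtain ⟨r, hr, hMr⟩ := exists_mem_matroidsOnOfRank hM
    simp only [Set.mem_iUnion]
    refine ⟨r, Finset.mem_range.2 (by omega), hMr, ?_⟩
    by_contra hno
    refine hMt ⟨hM, hn, fun r' hr' h1 h2 => ?_⟩
    have hrr : r' = r := by
      have := hMr.2
      rw [hr'] at this
      exact_mod_cast this
    subst hrr
    by_contra h3
    exact hno ⟨h1, h2, h3⟩
  have hfin : (⋃ r ∈ Finset.range (n + 1), S r).Finite :=
    finite_matroidsOn.subset (by
      intro M hM
      simp only [Set.mem_iUnion] at hM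
      obtain ⟨r, -, h, -⟩ := hM
      exact h.1)
  have h1 : (Matroid.matroidsOn n \ tameMatroids n).ncard ≤
      ∑ r ∈ Finset.range (n + 1), (S r).ncard :=
    (Set.ncard_le_ncard hsub hfin).trans (Finset.set_ncard_biUnion_le _ _)
  calc ((Matroid.matroidsOn n \ tameMatroids n).ncard : ℝ)
      ≤ ∑ r ∈ Finset.range (n + 1), ((S r).ncard : ℝ) := by exact_mod_cast h1
    _ ≤ ∑ _r ∈ Finset.range (n + 1), 2 * n * 2⁻¹ ^ n * ((Matroid.matroidsOn n).ncard : ℝ) :=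
        Finset.sum_le_sum fun r _ => hn.ncard_not_tame_le r
    _ = _ := by rw [Finset.sum_const, Finset.card_range, nsmul_eq_mul]; push_cast; ring

theorem containsAlmostAll_tameMatroids : Matroid.ContainsAlmostAll tameMatroids := by
  have hlim : Tendsto (fun n : ℕ => 1 - ((n : ℝ) + 1) * (2 * n * 2⁻¹ ^ n)) atTop (𝓝 1) := by
    have h1 := tendsto_pow_const_div_const_pow_of_one_lt 1 (r := (2 : ℝ)) (by norm_num)
    have h2 := tendsto_pow_const_div_const_pow_of_one_lt 2 (r := (2 : ℝ)) (by norm_num)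
    have h3 := ((h2.const_mul 2).add (h1.const_mul 2)).const_sub 1
    simp only [mul_zero, add_zero, sub_zero] at h3
    refine h3.congr fun n => ?_
    rw [inv_pow]
    ring
  refine tendsto_of_tendsto_of_tendsto_of_le_of_le' hlim tendsto_const_nhds ?_ ?_
  · filter_upwards [eventually_isLarge] with n hn
    have hfin : (Matroid.matroidsOn n).Finite := finite_matroidsOn
    have hpos : 0 < (Matroid.matroidsOn n).ncard :=
      (Set.ncard_pos hfin).2 ⟨Matroid.loopyOn Set.univ, rfl⟩
    have hpos' : (0 : ℝ) < (Matroid.matroidsOn n).ncard := by exact_mod_cast hpos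
    have h1 := hn.ncard_diff_tameMatroids_le
    have h2 : (Matroid.matroidsOn n \ tameMatroids n).ncard +
        (tameMatroids n ∩ Matroid.matroidsOn n).ncard = (Matroid.matroidsOn n).ncard := by
      rw [Set.inter_comm, add_comm]
      exact Set.ncard_inter_add_ncard_sdiff_eq_ncard _ _ hfin
    have h2' : ((Matroid.matroidsOn n \ tameMatroids n).ncard : ℝ) +
        (tameMatroids n ∩ Matroid.matroidsOn n).ncard = (Matroid.matroidsOn n).ncard := by
      exact_mod_cast h2
    rw [le_div_iff₀ hpos']
    linarith
  · refine Eventually.of_forall fun n => ?_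
    apply div_le_one_of_le₀ _ (Nat.cast_nonneg _)
    exact_mod_cast Set.ncard_le_ncard Set.inter_subset_right finite_matroidsOn

/-! ### Counting the families of big non-bases -/

/-- Non-bases are sets of size `r`, so there are at most `2 ^ (n choose r)` families of them. -/
theorem ncard_image_bigNonbases_le (𝒮 : Set (Matroid (Fin n))) (r : ℕ)
    (h𝒮 : 𝒮 ⊆ Matroid.matroidsOnOfRank n r) :
    (Matroid.bigNonbases '' 𝒮).ncard ≤ 2 ^ n.choose r := by
  classical
  set P := (Finset.powersetCard r (Finset.univ : Finset (Fin n))).powerset with hP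
  have hsub : Matroid.bigNonbases '' 𝒮 ⊆ (fun T : Finset (Finset (Fin n)) =>
      (fun X : Finset (Fin n) => (X : Set (Fin n))) '' (T : Set (Finset (Fin n)))) '' P := by
    rintro _ ⟨M, hM, rfl⟩
    refine ⟨Finset.univ.filter fun X : Finset (Fin n) => (X : Set (Fin n)) ∈ M.bigNonbases, ?_, ?_⟩
    · rw [Finset.mem_coe, hP, Finset.mem_powerset]
      intro X hX
      have h := ((Finset.mem_filter.1 hX).2).1.2.1
      rw [(h𝒮 hM).2, Set.encard_coe_eq_coe_finsetCard] at h
      exact Finset.mem_powersetCard.2 ⟨Finset.subset_univ _, by exact_mod_cast h⟩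
    · ext X
      lift X to Finset (Fin n) using Set.toFinite X
      simp
  calc (Matroid.bigNonbases '' 𝒮).ncard ≤ _ := Set.ncard_le_ncard hsub (Set.toFinite _)
    _ ≤ (P : Set (Finset (Finset (Fin n)))).ncard := Set.ncard_image_le (Set.toFinite _)
    _ = 2 ^ n.choose r := by
      rw [Set.ncard_coe_finset, hP, Finset.card_powerset, Finset.card_powersetCard,
        Finset.card_univ, Fintype.card_fin]

theorem IsLarge.ncard_image_tame_le (hn : IsLarge n) (hr1 : n ≤ 4 * r) (hr2 : 4 * r ≤ 3 * n) :
    ((Matroid.bigNonbases '' (Matroid.matroidsOnOfRank n r ∩ tameMatroids n)).ncard : ℝ) ≤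
      2 ^ (57000 * (scale n * Real.logb 2 n ^ 2)) := by
  classical
  have h12 := hn.le
  set S := Matroid.matroidsOnOfRank n r ∩ tameMatroids n with hS
  have hSfin : S.Finite := finite_matroidsOn.subset fun M hM => hM.1.1
  set 𝒦 := hSfin.toFinset.image fun M => nonbasisFamily M r with h𝒦
  have hsub : Matroid.bigNonbases '' S ⊆ (fun T : Finset (Finset (Fin n)) =>
      (fun X : Finset (Fin n) => (X : Set (Fin n))) '' (T : Set (Finset (Fin n)))) ''
        (𝒦.image clustered : Finset (Finset (Finset (Fin n)))) := by
    rintro _ ⟨M, hM, rfl⟩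
    rw [bigNonbases_eq hM.1 (by omega) (by omega)]
    refine ⟨clustered (nonbasisFamily M r), ?_, rfl⟩
    rw [Finset.mem_coe]
    exact Finset.mem_image_of_mem _ (Finset.mem_image_of_mem (fun M => nonbasisFamily M r)
      (hSfin.mem_toFinset.2 hM))
  have h1 : (Matroid.bigNonbases '' S).ncard ≤ (𝒦.image clustered).card := by
    calc (Matroid.bigNonbases '' S).ncard ≤ _ := Set.ncard_le_ncard hsub (Set.toFinite _)
      _ ≤ ((𝒦.image clustered : Finset (Finset (Finset (Fin n)))) :
          Set (Finset (Finset (Fin n)))).ncard := Set.ncard_image_le (Set.toFinite _)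
      _ = (𝒦.image clustered).card := Set.ncard_coe_finset _
  have h2 := card_image_clustered_le (r := r) (t := n / 10) (q := classBound n)
    (κ := coverBound n) 𝒦 (by
      intro K hK
      obtain ⟨M, hM, rfl⟩ := Finset.mem_image.1 hK
      rw [Set.Finite.mem_toFinset] at hM
      exact hM.2.2.2 r hM.1.2 hr1 hr2)
  have h3 : ((Matroid.bigNonbases '' S).ncard : ℝ) ≤
      ((smallFamilies (Fin n) (coverBound n)).card : ℝ) ^ 3 *
        (smallFamilies (Fin n) (16 * classBound n)).card := by
    exact_mod_cast h1.trans h2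
  refine h3.trans ?_
  have h4 := hn.card_smallFamilies_pow_le
  have h5 := hn.card_smallFamilies_le (16 * classBound n)
  have hL := hn.one_le_logb
  have hA := hn.scale_le
  have hq := hn.classBound_le
  calc _ ≤ (2 : ℝ) ^ (1146 * (scale n * Real.logb 2 n)) *
        2 ^ (3 * (16 * classBound n) * Real.logb 2 n + 4 * scale n) := by gcongr
    _ = 2 ^ (1146 * (scale n * Real.logb 2 n) +
        (3 * (16 * classBound n) * Real.logb 2 n + 4 * scale n)) := by
        rw [Real.rpow_add (by norm_num) (1146 * (scale n * Real.logb 2 n))]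
    _ ≤ _ := by
        apply Real.rpow_le_rpow_of_exponent_le (by norm_num)
        have h6 : (classBound n : ℝ) * Real.logb 2 n ≤
            1149 * (scale n * Real.logb 2 n) * Real.logb 2 n := by gcongr
        have h0 : 0 ≤ scale n * Real.logb 2 n := by
          have := hn.le_scale
          have : (0 : ℝ) ≤ n := Nat.cast_nonneg n
          linarith
        have h7 : scale n * Real.logb 2 n ≤ scale n * Real.logb 2 n ^ 2 := by
          rw [sq, ← mul_assoc]
          exact le_mul_of_one_le_right h0 hL
        nlinarith

end

end

end MatroidCount

theorem theorem1p3 :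
    ∃ c : ℝ, 0 < c ∧
      ∃ 𝒩 : (n : ℕ) → Set (Matroid (Fin n)),
        (∀ n : ℕ, 𝒩 n ⊆ Matroid.matroidsOn n) ∧
        Matroid.ContainsAlmostAll 𝒩 ∧
        ∀ n r : ℕ, 1 ≤ n → r ≤ n →
          Real.logb 2
              ((Matroid.bigNonbases '' (Matroid.matroidsOnOfRank n r ∩ 𝒩 n)).ncard : ℝ)
            ≤ c * (Real.logb 2 (n : ℝ) ^ 3 / (n : ℝ) ^ 2) * (n.choose (n / 2) : ℝ) := by
  refine ⟨57000, by norm_num, MatroidCount.tameMatroids, fun n M hM => hM.1,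
    MatroidCount.containsAlmostAll_tameMatroids, fun n r hn1 hrn => ?_⟩
  have hlog : 0 ≤ Real.logb 2 (n : ℝ) := Real.logb_nonneg (by norm_num) (by exact_mod_cast hn1)
  by_cases hn : MatroidCount.IsLarge n
  swap
  · -- No matroid on `n` elements was selected.
    have : MatroidCount.tameMatroids n = ∅ := by
      ext M
      simp [MatroidCount.tameMatroids, hn]
    rw [this, Set.inter_empty, Set.image_empty, Set.ncard_empty]
    simp only [Nat.cast_zero, Real.logb_zero]
    positivity
  apply MatroidCount.logb_natCast_le (by positivity)
  by_cases hr : n ≤ 4 * r ∧ 4 * r ≤ 3 * n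
  · refine (hn.ncard_image_tame_le hr.1 hr.2).trans (le_of_eq ?_)
    rw [MatroidCount.scale]
    congr 1
    ring
  · have h1 := MatroidCount.ncard_image_bigNonbases_le
      (Matroid.matroidsOnOfRank n r ∩ MatroidCount.tameMatroids n) r Set.inter_subset_left
    have h2 := MatroidCount.sq_mul_choose_le hn.far hrn hr
    have hL := hn.one_le_logb
    have hn0 : (0 : ℝ) < n := by exact_mod_cast hn1
    have h3 : (n.choose r : ℝ) ≤ n.choose (n / 2) / (n : ℝ) ^ 2 := by
      rw [le_div_iff₀ (by positivity), mul_comm]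
      exact_mod_cast h2
    calc ((Matroid.bigNonbases '' (Matroid.matroidsOnOfRank n r ∩
          MatroidCount.tameMatroids n)).ncard : ℝ) ≤ 2 ^ n.choose r := by exact_mod_cast h1
      _ = (2 : ℝ) ^ (n.choose r : ℝ) := (Real.rpow_natCast _ _).symm
      _ ≤ _ := by
        apply Real.rpow_le_rpow_of_exponent_le (by norm_num)
        refine h3.trans ?_
        have h4 : (1 : ℝ) ≤ 57000 * Real.logb 2 (n : ℝ) ^ 3 := by
          have := one_le_pow₀ hL (n := 3)
          linarith
        calc (n.choose (n / 2) : ℝ) / (n : ℝ) ^ 2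
            = 1 * (n.choose (n / 2) / (n : ℝ) ^ 2) := (one_mul _).symm
          _ ≤ 57000 * Real.logb 2 (n : ℝ) ^ 3 * (n.choose (n / 2) / (n : ℝ) ^ 2) := by gcongr
          _ = _ := by ring
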